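/- For a finite set $V$, a family $\mathcal F\subseteq 2^V$ and $T\subseteq V$, let $\mathcal F_{|T}=\{F\cap T: F\in\mathcal F\}$. Write $(n,m)\to(a,b)$ if for every family $\mathcal F$ of subsets of an $n$-element set $V$ with $|\mathcal F|\ge m$ there is an $a$-element set $T\subseteq V$ with $|\mathcal F_{|T}|\ge b$. For integers $n\ge 1$ and $s\ge 0$ let $m(n,s)$ be the maximum integer $m\le 2^n$ such that $(n,m)\to(n-1,m-s)$, and let $m(s)=\lim_{n\to\infty} m(n,s)/n$. **Theorem.** Let $d\ge 50$ be an integer. 1. For every positive integer $n$ with $2d\mid n$, $$m(n,2^{d-1}-d)=\frac{2^d-d-\frac12}{d}\,n,$$ and the limit $m(2^{d-1}-d)$ exists and equals $\dfrac{2^d-d-\frac12}{d}$. 2. For every integer $c$ with $1\le c\le d-1$ and every positive integer $n$ with $d\mid n$, $$m(n,2^{d-1}-c)=\frac{2^d-c}{d}\,n,$$ and the limit $m(2^{d-1}-c)$ exists and equals $\dfrac{2^d-c}{d}$. -/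

import Mathlib

/-- The trace of a family `F` of subsets of `V` on `T`, i.e. the family of all `A ∩ T`, `A ∈ F`. -/
def familyTrace {V : Type*} [DecidableEq V] (F : Finset (Finset V)) (T : Finset V) :
    Finset (Finset V) :=
  F.image (fun A => A ∩ T)

/-- The arrowing relation `(n, m) → (a, b)`: every family of at least `m` subsets of an `n`-element
set has a trace of size at least `b` on some `a`-element set. -/
def Arrows (n m a b : ℕ) : Prop :=
  ∀ F : Finset (Finset (Fin n)), m ≤ F.card →
    ∃ T : Finset (Fin n), T.card = a ∧ b ≤ (familyTrace F T).card

/-- `maxArrow n s` is the largest `m` with `(n, m) → (n - 1, m - s)`.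
Only `m ≤ 2 ^ n` compete: for `m > 2 ^ n` there is no family of `m` subsets of an `n`-element set and
the relation holds vacuously. The truncated subtraction `m - s` is harmless, as a bound `b ≤ 0` on a
cardinality is no condition. The supremum is an attained maximum, see
`isGreatest_maxArrow`. -/
noncomputable def maxArrow (n s : ℕ) : ℕ :=
  sSup {m : ℕ | m ≤ 2 ^ n ∧ Arrows n m (n - 1) (m - s)}

theorem isGreatest_maxArrow (n s : ℕ) :
    IsGreatest {m : ℕ | m ≤ 2 ^ n ∧ Arrows n m (n - 1) (m - s)} (maxArrow n s) := by
  have hb : BddAbove {m : ℕ | m ≤ 2 ^ n ∧ Arrows n m (n - 1) (m - s)} :=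
    ⟨2 ^ n, fun m hm => hm.1⟩
  refine ⟨Nat.sSup_mem ⟨0, Nat.zero_le _, fun F _ => ?_⟩ hb, fun m hm => le_csSup hb hm⟩
  obtain ⟨T, -, hT⟩ := Finset.exists_subset_card_eq
    (s := (Finset.univ : Finset (Fin n))) (n := n - 1) (by simp)
  exact ⟨T, hT, by simp⟩

namespace TraceSets

open Finset Finset.Colex
open scoped FinsetFamily

/-! ### Level sizes of a down-set -/

/-! Compression replaces a family by a down-set of the same size with no larger traces, and for a
down-set the loss in the trace on the complement of `v` is the degree of `v`. So the question is how
small a down-set `F` can be when every degree is at least `2 ^ (d - 1) - c + 1`.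

Let each nonempty member split weight one evenly among its elements. The weights sum to `#F - 1`, so
it suffices that they average at least `(2 ^ d - blockLoss d c) / d`. Join two vertices when they
form a member. The degree condition forces closed neighbourhoods of size at least `d`. If the
neighbourhood of `v` is larger, the link of `v` has a surplus of singletons, and Kruskal–Katona
(`card_slice_add_le`) shows that what it lacks elsewhere cannot cost more than `c - 1` members of
weight `1 / d`; so `v` alone has enough weight (`weight_ge_of_card_slice_one_gt`).

Neighbourhoods of size exactly `d` are blocks; they are cliques, and weight is averaged over them.
The complements of the sets missing from a block form a down-set `𝒟`. If no edge leaves the block,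
at most `c - 1` sets are missing. Any further missing set must be compensated by members leaving the
block, whose weight pays for it (`card_le_blockLoss_add_sum`). A vertex in several blocks carries so
much extra weight that it pays for all of them (`mul_div_le_card_sub_one`).

For the matching upper bound, copies of a cube without `c - 1` sets are glued along the empty set.
When `c = d` it is cheaper to remove `d` sets from each of two cubes and to repair one vertex of
each by a common edge, which costs each cube one half. -/

theorem exists_isInitSeg_card {n r t : ℕ} (ht : t ≤ n.choose r) :
    ∃ 𝒞 : Finset (Finset (Fin n)), IsInitSeg 𝒞 r ∧ #𝒞 = t := by
  induction t with
  | zero => exact ⟨∅, isInitSeg_empty, rfl⟩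
  | succ t ih =>
    obtain ⟨𝒞, h𝒞, hcard⟩ := ih (by omega)
    have hne : (powersetCard r univ \ 𝒞).Nonempty := by
      rw [← card_pos]
      have h1 := le_card_sdiff 𝒞 (powersetCard r (univ : Finset (Fin n)))
      have h2 : #(powersetCard r (univ : Finset (Fin n))) = n.choose r := by simp
      omega
    obtain ⟨A, hA, hmin⟩ := exists_min_image _ (fun s : Finset (Fin n) => toColex s) hne
    simp only [mem_sdiff, mem_powersetCard, subset_univ, true_and] at hA hmin
    refine ⟨insert A 𝒞, ⟨?_, ?_⟩, by rw [card_insert_of_notMem hA.2, hcard]⟩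
    · intro s hs
      rcases mem_insert.1 (mem_coe.1 hs) with rfl | h
      · exact hA.1
      · exact h𝒞.1 h
    · rintro s t hs ⟨hlt, htr⟩
      rw [mem_insert] at hs ⊢
      rcases hs with rfl | hs
      · by_contra! hcon
        exact absurd (hmin t ⟨htr, hcon.2⟩) (not_le.2 hlt)
      · exact Or.inr (h𝒞.2 hs ⟨hlt, htr⟩)

/-- The copy of `{0, …, k - 1}` in `Fin n`. -/
def initialFin (n k : ℕ) : Finset (Fin n) := univ.filter fun i => (i : ℕ) < k

theorem card_initialFin {n k : ℕ} (h : k ≤ n) : #(initialFin n k) = k := by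
  simp [initialFin, Fin.card_filter_val_lt, h]

theorem isInitSeg_powersetCard_initialFin (n k r : ℕ) :
    IsInitSeg (powersetCard r (initialFin n k)) r := by
  refine ⟨Set.sized_powersetCard _ _, ?_⟩
  rintro s t hs ⟨hlt, htr⟩
  rw [mem_powersetCard] at hs ⊢
  refine ⟨fun x hx => ?_, htr⟩
  rw [initialFin, mem_filter]
  refine ⟨mem_univ _, ?_⟩
  have h1 : toColex (image Fin.val t) < toColex (image Fin.val s) := by
    rwa [toColex_image_lt_toColex_image Fin.val_strictMono]
  refine forall_lt_mono h1.le ?_ _ (mem_image_of_mem _ hx)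
  intro b hb
  obtain ⟨y, hy, rfl⟩ := mem_image.1 hb
  exact (mem_filter.1 (hs.1 hy)).2

/-- The number of `i`-subsets of a set `K` that contain a given `J ⊆ K`. -/
theorem card_filter_superset {α : Type*} [DecidableEq α] {J K : Finset α} (hJ : J ⊆ K) {i : ℕ}
    (hi : #J ≤ i) :
    #((powersetCard i K).filter fun A => J ⊆ A) = (#K - #J).choose (i - #J) := by
  rw [← card_sdiff_of_subset hJ, ← card_powersetCard]
  refine card_bij' (fun A _ => A \ J) (fun A _ => A ∪ J) ?_ ?_ ?_ ?_
  · intro A hA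
    simp only [mem_filter, mem_powersetCard] at hA ⊢
    exact ⟨sdiff_subset_sdiff hA.1.1 le_rfl, by rw [card_sdiff_of_subset hA.2, hA.1.2]⟩
  · intro A hA
    simp only [mem_filter, mem_powersetCard] at hA ⊢
    have hd : Disjoint A J := (disjoint_of_subset_left hA.1 sdiff_disjoint)
    refine ⟨⟨union_subset (hA.1.trans sdiff_subset) hJ, ?_⟩, subset_union_right⟩
    rw [card_union_of_disjoint hd, hA.2]; omega
  · intro A hA
    simp only [mem_filter] at hA
    exact sdiff_union_of_subset hA.2
  · intro A hA
    simp only [mem_powersetCard] at hA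
    have hd : Disjoint A J := (disjoint_of_subset_left hA.1 sdiff_disjoint)
    exact union_sdiff_cancel_right hd

/-- If a down-set has fewer than `k.choose j` sets of size `j`, then at each size `i` between `j`
and `k` it misses at least as many sets as the `k`-cube without the sets above a fixed `j`-set. -/
theorem card_slice_add_le {n k j i : ℕ} (L : Finset (Finset (Fin n)))
    (hL : IsLowerSet (L : Set (Finset (Fin n)))) (hk : k ≤ n) (hji : j ≤ i) (hik : i ≤ k)
    (hj : #(L # j) < k.choose j) :
    #(L # i) + (k - j).choose (i - j) ≤ k.choose i := by
  by_contra! hcon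
  have hsub : (k - j).choose (i - j) ≤ k.choose i := by
    have h := card_le_card (filter_subset (fun A => initialFin n j ⊆ A)
      (powersetCard i (initialFin n k)))
    have hs : initialFin n j ⊆ initialFin n k := by
      intro x hx
      simp only [initialFin, mem_filter, mem_univ, true_and] at hx ⊢
      omega
    rw [card_filter_superset hs (by rw [card_initialFin (by omega)]; exact hji),
      card_powersetCard, card_initialFin hk, card_initialFin (by omega)] at h
    exact h
  have hpos : 0 < (k - j).choose (i - j) := Nat.choose_pos (by omega)
  -- No larger than the slice `L # i` under `hcon`, yet it omits fewer than `(k - j).choose (i - j)`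
  -- of the `i`-sets of the `k`-cube. So each `j`-set of the cube lies below a member, and
  -- Kruskal–Katona makes `L # j` too large.
  obtain ⟨𝒞, h𝒞, hcard⟩ := exists_isInitSeg_card (n := n) (r := i)
    (t := k.choose i + 1 - (k - j).choose (i - j))
    ((by omega : _ ≤ k.choose i).trans (Nat.choose_le_choose _ hk))
  have hcube : #(powersetCard i (initialFin n k)) = k.choose i := by
    rw [card_powersetCard, card_initialFin hk]
  have h𝒞K : 𝒞 ⊆ powersetCard i (initialFin n k) := by
    rcases h𝒞.total (isInitSeg_powersetCard_initialFin n k i) with h | h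
    · exact h
    · exact (eq_of_subset_of_card_le h (by omega)).symm.subset
  have hkk := iterated_kk (k := i - j) (𝒜 := L # i) (sized_slice) (by omega) h𝒞
  have h1 : powersetCard j (initialFin n k) ⊆ ∂^[i - j] 𝒞 := by
    intro J hJ
    rw [mem_powersetCard] at hJ
    have h2 := card_filter_superset hJ.1 (i := i) (by omega)
    rw [card_initialFin hk, hJ.2] at h2
    have h3 : ((powersetCard i (initialFin n k)).filter (fun A => J ⊆ A) ∩ 𝒞).Nonempty := by
      by_contra hem
      rw [not_nonempty_iff_eq_empty, ← disjoint_iff_inter_eq_empty] at hem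
      have h4 := card_le_card (union_subset (filter_subset (fun A => J ⊆ A) _) h𝒞K)
      rw [card_union_of_disjoint hem] at h4
      omega
    obtain ⟨A, hA⟩ := h3
    simp only [mem_inter, mem_filter, mem_powersetCard] at hA
    rw [mem_shadow_iterate_iff_exists_mem_card_add]
    exact ⟨A, hA.2, hA.1.2, by omega⟩
  have h2 : ∂^[i - j] (L # i) ⊆ L # j := by
    intro J hJ
    rw [mem_shadow_iterate_iff_exists_mem_card_add] at hJ
    obtain ⟨A, hA, hJA, hc⟩ := hJ
    rw [mem_slice] at hA ⊢
    exact ⟨hL hJA hA.1, by omega⟩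
  have h3 := card_le_card h1
  have h4 := card_le_card h2
  rw [card_powersetCard, card_initialFin hk] at h3
  omega

theorem sum_card_slice_mul {n : ℕ} (L : Finset (Finset (Fin n))) (f : ℕ → ℝ) :
    ∑ A ∈ L, f #A = ∑ i ∈ range (n + 1), (#(L # i) : ℝ) * f i := by
  rw [← sum_fiberwise_of_maps_to (t := range (n + 1)) (g := fun A : Finset (Fin n) => #A)]
  · refine sum_congr rfl fun i _ => ?_
    rw [sum_congr rfl (g := fun _ => f i) (fun A hA => by rw [(mem_filter.1 hA).2]), sum_const,
      nsmul_eq_mul]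
    rfl
  · intro A _
    have := card_le_univ A
    simp only [Fintype.card_fin] at this
    simp only [mem_range]; omega

theorem sum_choose_div (k : ℕ) :
    ∑ i ∈ range (k + 1), (k.choose i : ℝ) / (i + 1) = (2 ^ (k + 1) - 1) / (k + 1) := by
  have h1 : ∀ i, (k.choose i : ℝ) / (i + 1) = ((k + 1).choose (i + 1) : ℝ) / (k + 1) := by
    intro i
    have h := Nat.add_one_mul_choose_eq k i
    have h' : ((k : ℝ) + 1) * k.choose i = (k + 1).choose (i + 1) * (i + 1) := by exact_mod_cast h
    field_simp
    linarith
  simp_rw [h1]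
  rw [← sum_div]
  congr 1
  have h2 := Nat.sum_range_choose (k + 1)
  rw [sum_range_succ'] at h2
  have h3 : ((∑ i ∈ range (k + 1), (k + 1).choose (i + 1) : ℕ) : ℝ) + 1 = 2 ^ (k + 1) := by
    exact_mod_cast h2
  push_cast at h3
  linarith

end TraceSets

/-! ### Weight of a vertex with a large neighbourhood -/

namespace TraceSets

open Finset

theorem sq_le_two_pow {m : ℕ} (hm : 16 ≤ m) : (3 * m + 2) ^ 2 ≤ 2 ^ m := by
  induction m, hm using Nat.le_induction with
  | base => norm_num
  | succ m hm ih => rw [pow_succ 2]; nlinarith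

/-- The numerical core of the local weight inequality: `x` is the surplus at level one, `E` the
total surplus below level `j`, and `D` the total deficit from level `j` on. -/
theorem surplus_sub_deficit_ge {j k : ℕ} {c x E D : ℝ} (hj : 2 ≤ j) (hjk : j ≤ k) (hk : 49 ≤ k)
    (hc : 1 ≤ c) (hck : c ≤ k + 1) (hx : 1 ≤ x) (hxE : x ≤ E) (hED : D ≤ E + (c - 1))
    (hD : (2 : ℝ) ^ (k - j) ≤ D) :
    -(c - 1) / (k + 1) ≤ x / 2 + (E - x) / j - D / (j + 1) := by
  have hj' : (2 : ℝ) ≤ j := by exact_mod_cast hj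
  have hjk' : (j : ℝ) ≤ k := by exact_mod_cast hjk
  have hk' : (49 : ℝ) ≤ k := by exact_mod_cast hk
  have hj0 : (0 : ℝ) < j := by linarith
  have h1 : D / (j + 1) ≤ (E + (c - 1)) / (j + 1) := by gcongr
  have hx1 : x / 2 - x / j ≥ 1 / 2 - 1 / j := by
    have : x / 2 - x / j - (1 / 2 - 1 / j) = (x - 1) * ((j - 2) / (2 * j)) := by
      field_simp
    have h2 : 0 ≤ (x - 1) * (((j : ℝ) - 2) / (2 * j)) :=
      mul_nonneg (by linarith) (div_nonneg (by linarith) (by linarith))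
    linarith
  have hhalf : (1 : ℝ) / j ≤ 1 / 2 := by
    rw [div_le_div_iff₀ hj0 (by norm_num)]; linarith
  -- For large `j` the gain `1 / 2 - 1 / j` from level one covers the loss. Otherwise `2 ^ (k - j)`
  -- is at least `(j + 1) * k`, so `E` is at least `j * (c - 1)` and the surplus outweighs the
  -- deficit.
  by_cases hcase : 2 * k ≤ 3 * (j - 1)
  · have hcase' : 2 * (k : ℝ) ≤ 3 * (j - 1) := by
      have : 2 * k + 3 ≤ 3 * j := by omega
      have : 2 * (k : ℝ) + 3 ≤ 3 * j := by exact_mod_cast this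
      linarith
    have key : 0 ≤ 1 / 2 - 1 / (j : ℝ) + (E / j - (E + (c - 1)) / (j + 1)) + (c - 1) / (k + 1) := by
      have e1 : E / j - (E + (c - 1)) / (j + 1) = E / (j * (j + 1)) - (c - 1) / (j + 1) := by
        field_simp; ring
      have e2 : (c - 1) / ((j : ℝ) + 1) - (c - 1) / (k + 1) = (c - 1) * ((k - j) / ((j + 1) * (k + 1))) := by
        field_simp; ring
      have e3 : (c - 1) * (((k : ℝ) - j) / ((j + 1) * (k + 1))) ≤ k * ((k - j) / ((j + 1) * (k + 1))) :=
        mul_le_mul_of_nonneg_right (by linarith) (div_nonneg (by linarith) (by positivity))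
      have e4 : (k : ℝ) * ((k - j) / ((j + 1) * (k + 1))) ≤ (k - j) / (j + 1) := by
        rw [mul_div_assoc', div_le_div_iff₀ (by positivity) (by positivity)]
        have : 0 ≤ ((k : ℝ) - j) * (j + 1) := mul_nonneg (by linarith) (by linarith)
        nlinarith
      have e5 : 1 / ((j : ℝ) * (j + 1)) ≤ E / (j * (j + 1)) := by
        gcongr; linarith
      have e6 : 0 ≤ 1 / 2 - 1 / (j : ℝ) + 1 / (j * (j + 1)) - (k - j) / (j + 1) := by
        have : 1 / 2 - 1 / (j : ℝ) + 1 / (j * (j + 1)) - (k - j) / (j + 1)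
            = (3 * (j - 1) + 2 - 2 * k) / (2 * (j + 1)) := by
          field_simp; ring
        rw [this]
        apply div_nonneg <;> linarith
      linarith
    have e7 : (E - x) / j = E / j - x / j := by ring
    have e8 : -(c - 1) / ((k : ℝ) + 1) = - ((c - 1) / (k + 1)) := by ring
    rw [e7, e8]
    linarith
  · have hjk2 : j + 1 ≤ k := by omega
    have hp := sq_le_two_pow (m := k - j) (by omega)
    have h2 : (j + 1) * k ≤ 2 ^ (k - j) :=
      le_trans (le_trans (Nat.mul_le_mul (by omega) (by omega)) (le_of_eq (sq _).symm)) hp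
    have h2' : ((j : ℝ) + 1) * k ≤ 2 ^ (k - j) := by exact_mod_cast h2
    have hE : (j : ℝ) * (c - 1) ≤ E := by nlinarith
    have e1 : E / j - (E + (c - 1)) / (j + 1) = (E - j * (c - 1)) / (j * (j + 1)) := by
      field_simp; ring
    have e2 : 0 ≤ (E - j * (c - 1)) / ((j : ℝ) * (j + 1)) :=
      div_nonneg (by linarith) (by positivity)
    have e8 : -(c - 1) / ((k : ℝ) + 1) ≤ 0 :=
      div_nonpos_of_nonpos_of_nonneg (by linarith) (by linarith)
    have e7 : (E - x) / j = E / j - x / j := by ring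
    rw [e7]
    linarith

/-- A down-set with nearly `2 ^ k` members and more than `k` vertices weighs at least as much as the
`k`-cube without `c - 1` members of weight `1 / (k + 1)`. -/
theorem weight_ge_of_card_slice_one_gt {n k c : ℕ} (L : Finset (Finset (Fin n)))
    (hL : IsLowerSet (L : Set (Finset (Fin n)))) (hk : 49 ≤ k) (hc : 1 ≤ c) (hck : c ≤ k + 1)
    (hcard : 2 ^ k + 1 ≤ #L + c) (hone : k + 1 ≤ #(L # 1)) :
    ((2 : ℝ) ^ (k + 1) - c) / (k + 1) ≤ ∑ A ∈ L, 1 / ((#A : ℝ) + 1) := by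
  have hkn : k + 1 ≤ n := by
    have h1 : #(L # 1) ≤ n.choose 1 := by
      have h2 : L # 1 ⊆ powersetCard 1 univ := by
        intro A hA
        rw [mem_slice] at hA
        simp [mem_powersetCard, hA.2]
      simpa using card_le_card h2
    simp at h1; omega
  rw [sum_card_slice_mul L (fun i => 1 / ((i : ℝ) + 1))]
  have hsplit : ∀ g : ℕ → ℝ, (∀ i, 0 ≤ g i) →
      ∑ i ∈ range (k + 1), g i ≤ ∑ i ∈ range (n + 1), g i := fun g hg =>
    sum_le_sum_of_subset_of_nonneg (range_subset_range.2 (by omega)) fun i _ _ => hg i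
  have hW := hsplit (fun i => (#(L # i) : ℝ) * (1 / ((i : ℝ) + 1))) (fun i => by positivity)
  refine le_trans ?_ hW
  have hcube := sum_choose_div k
  have hc' : (1 : ℝ) ≤ c := by exact_mod_cast hc
  have hck' : (c : ℝ) ≤ k + 1 := by exact_mod_cast hck
  have htarget : ((2 : ℝ) ^ (k + 1) - c) / (k + 1)
      = (2 ^ (k + 1) - 1) / (k + 1) + -(c - 1) / (k + 1) := by ring
  rw [htarget, ← hcube]
  by_cases hall : ∀ i ≤ k, k.choose i ≤ #(L # i)
  · have h1 : ∑ i ∈ range (k + 1), (k.choose i : ℝ) / (i + 1)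
        ≤ ∑ i ∈ range (k + 1), (#(L # i) : ℝ) * (1 / ((i : ℝ) + 1)) := by
      refine sum_le_sum fun i hi => ?_
      have := hall i (by simp at hi; omega)
      have : (k.choose i : ℝ) ≤ #(L # i) := by exact_mod_cast this
      rw [mul_one_div]
      gcongr
    have h2 : -((c : ℝ) - 1) / (k + 1) ≤ 0 :=
      div_nonpos_of_nonpos_of_nonneg (by linarith) (by positivity)
    linarith
  push Not at hall
  classical
  -- The first level at which `L` falls short of the `k`-cube. Below it every level has a surplus;
  -- from it up to `k` every level has a deficit by `card_slice_add_le`.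
  obtain ⟨hjk, hjlt⟩ := Nat.find_spec hall
  have hmin : ∀ i < Nat.find hall, k.choose i ≤ #(L # i) := by
    intro i hi
    have := Nat.find_min hall hi
    push Not at this
    exact this (by omega)
  generalize Nat.find hall = j at hjk hjlt hmin
  have hj2 : 2 ≤ j := by
    by_contra! hlt
    have hLne : L.Nonempty := by
      rw [← card_pos]
      have : c < 2 ^ k := by
        have : k + 1 < 2 ^ k := by
          have := sq_le_two_pow (m := k) (by omega); nlinarith
        omega
      omega
    obtain ⟨A, hA⟩ := hLne
    interval_cases j
    · have : (∅ : Finset (Fin n)) ∈ L # 0 := by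
        rw [mem_slice]; exact ⟨hL (empty_subset A) hA, rfl⟩
      have := card_pos.2 ⟨_, this⟩
      rw [Nat.choose_zero_right] at hjlt; omega
    · simp at hjlt; omega
  have hup : ∀ i, j ≤ i → i ≤ k → #(L # i) + (k - j).choose (i - j) ≤ k.choose i :=
    fun i h1 h2 => card_slice_add_le L hL (by omega) h1 h2 hjlt
  have hzero : ∀ i, k < i → #(L # i) = 0 := by
    intro i hi
    have h0 : #(L # k) = 0 := by
      have := hup k hjk le_rfl
      simp at this ⊢
      exact this
    rw [card_eq_zero] at h0 ⊢
    rw [eq_empty_iff_forall_notMem] at h0 ⊢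
    intro A hA
    rw [mem_slice] at hA
    obtain ⟨B, hBA, hB⟩ := exists_subset_card_eq (s := A) (n := k) (by omega)
    exact h0 B (mem_slice.2 ⟨hL hBA hA.1, hB⟩)
  set x : ℕ → ℝ := fun i => (#(L # i) : ℝ) - k.choose i with hx
  have hdiff : ∑ i ∈ range (k + 1), (#(L # i) : ℝ) * (1 / ((i : ℝ) + 1))
      - ∑ i ∈ range (k + 1), (k.choose i : ℝ) / (i + 1) = ∑ i ∈ range (k + 1), x i / (i + 1) := by
    rw [← sum_sub_distrib]
    refine sum_congr rfl fun i _ => ?_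
    simp only [hx]; ring
  have hcardL : (#L : ℝ) = ∑ i ∈ range (k + 1), (#(L # i) : ℝ) := by
    have h := sum_card_slice_mul L (fun _ => 1)
    simp only [sum_const, nsmul_eq_mul, mul_one] at h
    rw [h]
    refine (sum_subset (range_subset_range.2 (by omega)) ?_).symm
    intro i _ hi
    rw [hzero i (by simp at hi; omega)]; simp
  have hsumx : ∑ i ∈ range (k + 1), x i = #L - 2 ^ k := by
    simp only [hx, sum_sub_distrib]
    rw [← hcardL]
    congr 1
    exact_mod_cast Nat.sum_range_choose k
  have hdis := sum_range_add_sum_Ico x (show j ≤ k + 1 by omega)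
  have hdis' := sum_range_add_sum_Ico (fun i => x i / (i + 1)) (show j ≤ k + 1 by omega)
  have hxnonneg : ∀ i < j, 0 ≤ x i := by
    intro i hi
    have : (k.choose i : ℝ) ≤ #(L # i) := by exact_mod_cast hmin i hi
    simp only [hx]; linarith
  set E := ∑ i ∈ range j, x i with hE
  set D := -∑ i ∈ Ico j (k + 1), x i with hD
  have hcard' : (2 : ℝ) ^ k + 1 ≤ #L + c := by exact_mod_cast hcard
  have hx1 : 1 ≤ x 1 := by
    have : (k : ℝ) + 1 ≤ #(L # 1) := by exact_mod_cast hone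
    simp only [hx, Nat.choose_one_right]; linarith
  have hsplit1 : ∀ g : ℕ → ℝ, ∑ i ∈ range j, g i = g 1 + ∑ i ∈ (range j).erase 1, g i := fun g =>
    (add_sum_erase (range j) g (mem_range.2 (by omega))).symm
  have hxE : x 1 ≤ E := by
    rw [hE, hsplit1]
    have : 0 ≤ ∑ i ∈ (range j).erase 1, x i :=
      sum_nonneg fun i hi => hxnonneg i (by simp at hi; omega)
    linarith
  have hDge : (2 : ℝ) ^ (k - j) ≤ D := by
    rw [hD, ← sum_neg_distrib]
    have h1 : ∑ i ∈ Ico j (k + 1), ((k - j).choose (i - j) : ℝ) = 2 ^ (k - j) := by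
      rw [sum_Ico_eq_sum_range]
      have h2 := Nat.sum_range_choose (k - j)
      rw [show k + 1 - j = k - j + 1 by omega]
      simp only [Nat.add_sub_cancel_left]
      exact_mod_cast h2
    rw [← h1]
    refine sum_le_sum fun i hi => ?_
    rw [mem_Ico] at hi
    have : (#(L # i) : ℝ) + (k - j).choose (i - j) ≤ k.choose i := by
      exact_mod_cast hup i hi.1 (by omega)
    simp only [hx]; linarith
  have hcore := surplus_sub_deficit_ge hj2 hjk hk hc' hck' hx1 hxE (by linarith) hDge
  -- Surplus sets have size below `j` and weigh at least `1 / j`, those of size one even `1 / 2`;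
  -- deficit sets weigh at most `1 / (j + 1)`.
  have hlow : x 1 / 2 + (E - x 1) / j ≤ ∑ i ∈ range j, x i / (i + 1) := by
    rw [hsplit1 (fun i => x i / (i + 1)), hE, hsplit1 x]
    have : ∑ i ∈ (range j).erase 1, x i / j ≤ ∑ i ∈ (range j).erase 1, x i / ((i : ℝ) + 1) := by
      refine sum_le_sum fun i hi => ?_
      have hij : i < j := by simp at hi; omega
      have h1 : (i : ℝ) + 1 ≤ j := by exact_mod_cast hij
      exact div_le_div_of_nonneg_left (hxnonneg i hij) (by positivity) h1
    rw [← sum_div] at this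
    norm_num
    linarith
  have hhigh : -(D / (j + 1)) ≤ ∑ i ∈ Ico j (k + 1), x i / (i + 1) := by
    have h1 : -(D / (j + 1)) = ∑ i ∈ Ico j (k + 1), x i / ((j : ℝ) + 1) := by
      rw [hD, ← sum_div]; ring
    rw [h1]
    refine sum_le_sum fun i hi => ?_
    rw [mem_Ico] at hi
    have hneg : x i ≤ 0 := by
      have : (#(L # i) : ℝ) + (k - j).choose (i - j) ≤ k.choose i := by
        exact_mod_cast hup i hi.1 (by omega)
      have h0 : (0 : ℝ) ≤ (k - j).choose (i - j) := by positivity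
      simp only [hx]; linarith
    have h2 : (j : ℝ) + 1 ≤ i + 1 := by
      have : (j : ℝ) ≤ i := by exact_mod_cast hi.1
      linarith
    rw [div_le_div_iff₀ (by positivity) (by positivity)]
    nlinarith
  linarith

end TraceSets

/-! ### Counting the missing sets of a block -/

namespace TraceSets

open Finset

variable {α : Type*} [DecidableEq α]

/-- In a down-set at most half of the members contain a given element. -/
theorem card_filter_mem_le_card_filter_notMem {𝒟 : Finset (Finset α)}
    (h𝒟 : IsLowerSet (𝒟 : Set (Finset α))) (v : α) :
    #(𝒟.filter fun D => v ∈ D) ≤ #(𝒟.filter fun D => v ∉ D) := by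
  refine card_le_card_of_injOn (fun D => D.erase v) ?_ ?_
  · intro D hD
    simp only [coe_filter, Set.mem_ofPred_eq] at hD ⊢
    exact ⟨h𝒟 (erase_subset _ _) hD.1, notMem_erase _ _⟩
  · intro D hD E hE h
    simp only [coe_filter, Set.mem_ofPred_eq] at hD hE
    rw [← insert_erase hD.2, ← insert_erase hE.2]
    exact congrArg (insert v) h

theorem card_filter_mem_add_card_filter_notMem (𝒟 : Finset (Finset α)) (v : α) :
    #(𝒟.filter fun D => v ∈ D) + #(𝒟.filter fun D => v ∉ D) = #𝒟 :=
  card_filter_add_card_filter_not _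

theorem sum_card_filter_mem (S : Finset α) (𝒟 : Finset (Finset α)) :
    ∑ v ∈ S, #(𝒟.filter fun D => v ∈ D) = ∑ D ∈ 𝒟, #(S ∩ D) := by
  simp_rw [card_filter]
  rw [sum_comm]
  refine sum_congr rfl fun D _ => ?_
  rw [← card_filter, filter_mem_eq_inter]

/-- A member of size `a` puts `2 ^ a` sets into a down-set, so member sizes are logarithmic. The
linear bound is an equality at `d = 50`, `a = 6`. -/
theorem fifteen_mul_le {a d : ℕ} (hd : 50 ≤ d) (ha : 2 ^ a ≤ 2 * (d - 1)) : 15 * a ≤ d + 40 := by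
  by_cases h : a ≤ 6
  · omega
  · have key : ∀ a, 7 ≤ a → 30 * a ≤ 2 ^ a + 82 := by
      intro a ha
      induction a, ha using Nat.le_induction with
      | base => norm_num
      | succ m hm ih =>
        have : 2 ^ 7 ≤ 2 ^ m := Nat.pow_le_pow_right (by norm_num) hm
        rw [pow_succ]; omega
    have := key a (by omega)
    omega

/-- The last case of the block estimate: `τ` is the excess of missing sets, `a` their largest
complement, `p` the number of vertices that need not be heavy. The bounds on `a` and `hτ` give `10 *
τ ≥ 4 * d - 35`, which keeps `p` small compared to `d`. -/
theorem le_mul_sub_of_mul_lt {d τ a p : ℝ} (hd : 50 ≤ d) (ha : 15 * a ≤ d + 40)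
    (hτ : d + 1 - 2 * τ ≤ 3 * a) (hτd : τ ≤ d - 1) (hp : p * (τ - 3) ≤ a * (τ + (d - 1))) :
    τ ≤ 17 / 12 * (d - p) := by
  by_contra! hcon
  have h0 : 4 * d - 35 ≤ 10 * τ := by linarith
  have h1 : (17 * d - 12 * τ) * (τ - 3) ≤ 17 * p * (τ - 3) :=
    mul_le_mul_of_nonneg_right (by linarith) (by linarith)
  have h2 : 15 * (a * (τ + (d - 1))) ≤ (d + 40) * (τ + (d - 1)) := by
    rw [← mul_assoc]
    exact mul_le_mul_of_nonneg_right ha (by linarith)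
  have h3 : 15 * ((17 * d - 12 * τ) * (τ - 3)) ≤ 17 * ((d + 40) * (τ + (d - 1))) := by
    nlinarith
  nlinarith [mul_nonneg (sub_nonneg.2 h0) (sub_nonneg.2 hτd),
    mul_nonneg (sub_nonneg.2 h0) (sub_nonneg.2 hd), mul_nonneg (sub_nonneg.2 hτd) (sub_nonneg.2 hd),
    mul_nonneg (sub_nonneg.2 hd) (sub_nonneg.2 hd)]

/-- The loss allowed per block of `d` vertices. -/
noncomputable def blockLoss (d c : ℕ) : ℝ := if c = d then (d : ℝ) + 1 / 2 else c

theorem le_blockLoss (d c : ℕ) : (c : ℝ) ≤ blockLoss d c := by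
  unfold blockLoss; split_ifs with h
  · subst h; linarith
  · rfl

/-- A down-set `𝒟` of subsets of a `d`-set `B` such that few members avoid any given good vertex:
its size beyond `c - 1` is paid for by the weights of the bad vertices. -/
theorem card_le_blockLoss_add_sum {B G : Finset α} {𝒟 : Finset (Finset α)} {ω : α → ℝ} {d c : ℕ}
    (hB : #B = d) (hd : 50 ≤ d) (hcd : c ≤ d) (hGB : G ⊆ B) (hG : G.Nonempty)
    (h𝒟 : IsLowerSet (𝒟 : Set (Finset α)))
    (hgood : ∀ v ∈ G, #(𝒟.filter fun D => v ∉ D) + 1 ≤ c)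
    (hω : ∀ u ∈ B \ G, 1 / 2 ≤ ω u)
    (hω' : ∀ u ∈ B \ G, c + 3 ≤ #(𝒟.filter fun D => u ∉ D) → 17 / 12 ≤ ω u) :
    (#𝒟 : ℝ) ≤ blockLoss d c - 1 + ∑ u ∈ B \ G, ω u := by
  obtain ⟨v₀, hv₀⟩ := hG
  have hc1 : 1 ≤ c := le_trans (by omega) (hgood v₀ hv₀)
  have hωnn : ∀ u ∈ B \ G, 0 ≤ ω u := fun u hu => by linarith [hω u hu]
  have hsumnn : 0 ≤ ∑ u ∈ B \ G, ω u := sum_nonneg hωnn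
  have hloss := le_blockLoss d c
  rcases Nat.lt_or_ge #𝒟 c with hlt | hge
  · have : (#𝒟 : ℝ) + 1 ≤ c := by exact_mod_cast hlt
    linarith
  -- The excess to be paid for. At most `c - 1` members avoid a good vertex, so each good vertex has
  -- degree at least `τ`.
  obtain ⟨τ, hτ⟩ : ∃ τ, #𝒟 = τ + (c - 1) := ⟨#𝒟 - (c - 1), by omega⟩
  have hτ1 : 1 ≤ τ := by omega
  have hτR : (#𝒟 : ℝ) = τ + (c - 1) := by
    rw [hτ]; push_cast [Nat.cast_sub hc1]; ring
  have hdeg : ∀ v ∈ G, τ ≤ #(𝒟.filter fun D => v ∈ D) := by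
    intro v hv
    have h1 := card_filter_mem_add_card_filter_notMem 𝒟 v
    have h2 := hgood v hv
    omega
  have hτc : τ ≤ c - 1 := by
    have h1 := card_filter_mem_le_card_filter_notMem h𝒟 v₀
    have h2 := hgood v₀ hv₀
    have h3 := hdeg v₀ hv₀
    omega
  have hsing : ∀ v ∈ G, {v} ∈ 𝒟 := by
    intro v hv
    obtain ⟨D, hD⟩ := card_pos.1 (lt_of_lt_of_le hτ1 (hdeg v hv))
    rw [mem_filter] at hD
    exact h𝒟 (singleton_subset_iff.2 hD.2) hD.1
  have hempty : ∅ ∈ 𝒟 := h𝒟 (empty_subset {v₀}) (hsing v₀ hv₀)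
  have hGc : #G + 1 ≤ c := by
    have h1 : insert ∅ ((G.erase v₀).image fun v => ({v} : Finset α))
        ⊆ 𝒟.filter fun D => v₀ ∉ D := by
      intro D hD
      rw [mem_insert, mem_image] at hD
      rw [mem_filter]
      rcases hD with rfl | ⟨v, hv, rfl⟩
      · exact ⟨hempty, by simp⟩
      · exact ⟨hsing v (mem_of_mem_erase hv), by
          simpa using (ne_of_mem_erase hv).symm⟩
    have h2 := card_le_card h1
    rw [card_insert_of_notMem (by simp), card_image_of_injective _ singleton_injective,
      card_erase_of_mem hv₀] at h2
    have h3 := hgood v₀ hv₀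
    have h4 := card_pos.2 ⟨v₀, hv₀⟩
    omega
  have hb : #(B \ G) + #G = d := by rw [card_sdiff_add_card_eq_card hGB, hB]
  have hhalf : (#(B \ G) : ℝ) / 2 ≤ ∑ u ∈ B \ G, ω u := by
    have := card_nsmul_le_sum (B \ G) ω (1 / 2) hω
    rw [nsmul_eq_mul] at this
    linarith
  rcases Nat.lt_or_ge 1 τ with hτ2 | hτ2
  swap
  -- With at least `d - c + 1` bad vertices of weight one half, only `c = d` can leave a single one;
  -- this is the one case that uses the extra half in `blockLoss`.
  · have hτe : (τ : ℝ) = 1 := by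
      have : τ = 1 := by omega
      exact_mod_cast this
    rw [hτR, hτe]
    unfold blockLoss
    split_ifs with hcd'
    · have : (1 : ℝ) ≤ #(B \ G) := by
        have : 1 ≤ #(B \ G) := by omega
        exact_mod_cast this
      have : (c : ℝ) = d := by exact_mod_cast hcd'
      linarith
    · have : (2 : ℝ) ≤ #(B \ G) := by
        have : 2 ≤ #(B \ G) := by omega
        exact_mod_cast this
      linarith
  suffices hmain : (τ : ℝ) ≤ ∑ u ∈ B \ G, ω u by rw [hτR]; linarith
  by_cases hbτ : 2 * τ ≤ #(B \ G)
  · have : 2 * (τ : ℝ) ≤ #(B \ G) := by exact_mod_cast hbτ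
    linarith
  obtain ⟨D₀, hD₀, hmax⟩ := exists_max_image 𝒟 card ⟨∅, hempty⟩
  have ha : 2 ^ #D₀ ≤ 2 * (d - 1) := by
    have : D₀.powerset ⊆ 𝒟 := fun D hD => h𝒟 (mem_powerset.1 hD) hD₀
    have := card_le_card this
    rw [card_powerset] at this
    omega
  have ha15 := fifteen_mul_le hd ha
  set a := #D₀
  -- large members meet the good vertices many times
  set S := 𝒟.filter fun D => 2 ≤ #D with hS
  have hScard : #S + 1 + #G ≤ #𝒟 := by
    have h1 : Disjoint S (insert ∅ (G.image fun v => ({v} : Finset α))) := by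
      rw [disjoint_left]
      intro D hD hD'
      rw [hS, mem_filter] at hD
      rw [mem_insert, mem_image] at hD'
      rcases hD' with rfl | ⟨v, _, rfl⟩
      · simp at hD
      · simp at hD
    have h2 : S ∪ insert ∅ (G.image fun v => ({v} : Finset α)) ⊆ 𝒟 := by
      refine union_subset (filter_subset _ _) (insert_subset hempty ?_)
      intro D hD
      obtain ⟨v, hv, rfl⟩ := mem_image.1 hD
      exact hsing v hv
    have h3 := card_le_card h2
    rw [card_union_of_disjoint h1, card_insert_of_notMem (by simp),
      card_image_of_injective _ singleton_injective] at h3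
    omega
  have hScount : #G * (τ - 1) ≤ #S * a := by
    have h1 : ∀ v ∈ G, τ - 1 ≤ #(S.filter fun D => v ∈ D) := by
      intro v hv
      have h2 : (𝒟.filter fun D => v ∈ D) ⊆ insert {v} (S.filter fun D => v ∈ D) := by
        intro D hD
        rw [mem_filter] at hD
        rw [mem_insert, mem_filter, hS, mem_filter]
        by_cases h : 2 ≤ #D
        · exact Or.inr ⟨⟨hD.1, h⟩, hD.2⟩
        · left
          have : #D = 1 := by
            have := card_pos.2 ⟨v, hD.2⟩
            omega
          obtain ⟨w, rfl⟩ := card_eq_one.1 this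
          rw [mem_singleton.1 hD.2]
      have h3 := (card_le_card h2).trans (card_insert_le _ _)
      have h4 := hdeg v hv
      omega
    have h5 := card_nsmul_le_sum G _ _ h1
    rw [sum_card_filter_mem, smul_eq_mul] at h5
    refine h5.trans ?_
    rw [← smul_eq_mul]
    refine sum_le_card_nsmul _ _ _ fun D hD => ?_
    exact (card_le_card inter_subset_right).trans (hmax D (mem_filter.1 hD).1)
  -- Otherwise there are more than `3 * a` good vertices, while at most `3 * (τ - 1)` members, each
  -- of size at most `a`, remain to supply `τ - 1` incidences per good vertex.
  have hlow : d + 1 ≤ 2 * τ + 3 * a := by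
    by_contra! hcon
    have h1 : #G * (τ - 1) ≤ (τ + d - 2 - #G) * a :=
      hScount.trans (Nat.mul_le_mul_right _ (by omega))
    obtain ⟨t, rfl⟩ : ∃ t, τ = t + 1 := ⟨τ - 1, by omega⟩
    obtain ⟨r, hr⟩ : ∃ r, #G = d + 1 - 2 * (t + 1) + r := ⟨#G - (d + 1 - 2 * (t + 1)), by omega⟩
    obtain ⟨q, hq⟩ : ∃ q, d + 1 - 2 * (t + 1) = q + 3 * a + 1 :=
      ⟨d + 1 - 2 * (t + 1) - 3 * a - 1, by omega⟩
    have h2 : t + 1 + d - 2 - #G ≤ 3 * t := by omega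
    have h3 := h1.trans (Nat.mul_le_mul_right _ h2)
    simp only [Nat.add_sub_cancel] at h3
    rw [hr, hq] at h3
    have : 0 < t := by omega
    nlinarith [Nat.zero_le (q * t), Nat.zero_le (r * t)]
  -- Counting incidences bounds `P`, and a vertex outside `P` is avoided by at least `c + 3`
  -- members, so `hω'` makes it heavy.
  set P := B.filter fun v => τ ≤ #(𝒟.filter fun D => v ∈ D) + 3 with hP
  have hPcount : #P * (τ - 3) ≤ #𝒟 * a := by
    have h1 : ∀ v ∈ P, τ - 3 ≤ #(𝒟.filter fun D => v ∈ D) := by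
      intro v hv
      have := (mem_filter.1 hv).2
      omega
    have h5 := card_nsmul_le_sum P _ _ h1
    rw [sum_card_filter_mem, smul_eq_mul] at h5
    refine h5.trans ?_
    rw [← smul_eq_mul]
    refine sum_le_card_nsmul _ _ _ fun D hD => ?_
    exact (card_le_card inter_subset_right).trans (hmax D hD)
  have hGP : G ⊆ P := by
    intro v hv
    rw [hP, mem_filter]
    exact ⟨hGB hv, (hdeg v hv).trans (by omega)⟩
  have hheavy : 17 / 12 * ((d : ℝ) - #P) ≤ ∑ u ∈ B \ G, ω u := by
    have h1 : ∑ u ∈ B \ P, ω u ≤ ∑ u ∈ B \ G, ω u :=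
      sum_le_sum_of_subset_of_nonneg (sdiff_subset_sdiff le_rfl hGP) fun u hu _ => hωnn u hu
    have h2 : ∀ u ∈ B \ P, 17 / 12 ≤ ω u := by
      intro u hu
      refine hω' u (sdiff_subset_sdiff le_rfl hGP hu) ?_
      rw [mem_sdiff, hP, mem_filter] at hu
      have h3 := card_filter_mem_add_card_filter_notMem 𝒟 u
      have h4 : ¬ τ ≤ #(𝒟.filter fun D => u ∈ D) + 3 := fun h => hu.2 ⟨hu.1, h⟩
      omega
    have h3 := card_nsmul_le_sum (B \ P) ω _ h2
    have h4 : #(B \ P) + #P = d := by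
      rw [card_sdiff_add_card_eq_card (filter_subset _ _), hB]
    have h5 : (#(B \ P) : ℝ) = d - #P := by
      have : (#(B \ P) : ℝ) + #P = d := by exact_mod_cast h4
      linarith
    rw [nsmul_eq_mul, h5] at h3
    linarith
  refine le_trans ?_ hheavy
  refine le_mul_sub_of_mul_lt (a := a) (by exact_mod_cast hd) (by exact_mod_cast ha15) ?_ ?_ ?_
  · have : (d : ℝ) + 1 ≤ 2 * τ + 3 * a := by exact_mod_cast hlow
    linarith
  · have h1 : τ + 1 ≤ d := by omega
    have : (τ : ℝ) + 1 ≤ d := by exact_mod_cast h1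
    linarith
  · have h3 : 3 ≤ τ := by omega
    have h1 : (#P : ℝ) * (τ - 3) ≤ #𝒟 * a := by
      have h := hPcount
      zify [h3] at h
      exact_mod_cast h
    have h2 : (#𝒟 : ℝ) ≤ τ + (d - 1) := by
      have : (c : ℝ) ≤ d := by exact_mod_cast hcd
      linarith
    nlinarith [Nat.cast_nonneg (α := ℝ) a]

end TraceSets

namespace TraceSets

open Finset

variable {α : Type*} [DecidableEq α]

/-! ### Weights and neighbourhoods -/

/-- The members of `F` that contain `v`. -/
def star (F : Finset (Finset α)) (v : α) : Finset (Finset α) := F.filter fun H => v ∈ H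

/-- The weight of `v` when every member of `F` distributes weight one evenly over its elements. -/
noncomputable def weight (F : Finset (Finset α)) (v : α) : ℝ := ∑ H ∈ star F v, 1 / (#H : ℝ)

theorem mem_star {F : Finset (Finset α)} {v : α} {H : Finset α} :
    H ∈ star F v ↔ H ∈ F ∧ v ∈ H := mem_filter

theorem weight_nonneg (F : Finset (Finset α)) (v : α) : 0 ≤ weight F v :=
  sum_nonneg fun _ _ => by positivity

theorem sum_weight {F : Finset (Finset α)} {B : Finset α} (hF : ∀ H ∈ F, H ⊆ B) (h0 : ∅ ∈ F) :
    ∑ v ∈ B, weight F v = #F - 1 := by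
  have h1 : ∀ v, weight F v = ∑ H ∈ F, if v ∈ H then 1 / (#H : ℝ) else 0 := fun v => by
    rw [weight, star, sum_filter]
  simp_rw [h1]
  rw [sum_comm]
  have h2 : ∀ H ∈ F, (∑ v ∈ B, if v ∈ H then 1 / (#H : ℝ) else 0) = if H = ∅ then 0 else 1 := by
    intro H hH
    rw [← sum_filter, filter_mem_eq_inter, inter_eq_right.2 (hF H hH), sum_const, nsmul_eq_mul]
    split_ifs with h
    · simp [h]
    · have : (#H : ℝ) ≠ 0 := by
        simpa using h
      field_simp
  rw [sum_congr rfl h2, ← add_sum_erase F _ h0,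
    sum_congr rfl (g := fun _ => (1 : ℝ)) (fun H hH => if_neg (ne_of_mem_erase hH)), sum_const,
    card_erase_of_mem h0, nsmul_eq_mul, Nat.cast_sub (card_pos.2 ⟨_, h0⟩)]
  simp

theorem weight_filter_add_weight_filter_not (F : Finset (Finset α)) (p : Finset α → Prop)
    [DecidablePred p] (v : α) :
    weight (F.filter p) v + weight (F.filter fun H => ¬ p H) v = weight F v := by
  unfold weight star
  rw [filter_comm, filter_comm (p := fun H => ¬ p H)]
  exact sum_filter_add_sum_filter_not _ _ _

theorem weight_le_weight {F G : Finset (Finset α)} (h : F ⊆ G) (v : α) :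
    weight F v ≤ weight G v :=
  sum_le_sum_of_subset_of_nonneg (filter_subset_filter _ h) fun _ _ _ => by positivity

theorem card_div_le_weight {F : Finset (Finset α)} {v : α} {d : ℕ} (h : ∀ H ∈ F, #H ≤ d) :
    (#(star F v) : ℝ) / d ≤ weight F v := by
  have h1 := card_nsmul_le_sum (star F v) (fun H => 1 / (#H : ℝ)) (1 / (d : ℝ)) fun H hH => by
    rw [mem_star] at hH
    have h2 : 0 < #H := card_pos.2 ⟨v, hH.2⟩
    have h3 := h H hH.1
    gcongr
  rw [nsmul_eq_mul] at h1
  rw [weight]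
  rwa [mul_one_div] at h1

/-- The link of `v`, on which the weight of `v` is a sum over a down-set. -/
def link (F : Finset (Finset α)) (v : α) : Finset (Finset α) := (star F v).image fun H => H.erase v

theorem injOn_erase_star (F : Finset (Finset α)) (v : α) :
    Set.InjOn (fun H : Finset α => H.erase v) (star F v) := by
  intro D hD E hE h
  rw [mem_coe, mem_star] at hD hE
  rw [← insert_erase hD.2, ← insert_erase hE.2]
  exact congrArg (insert v) h

theorem card_link (F : Finset (Finset α)) (v : α) : #(link F v) = #(star F v) :=
  card_image_of_injOn (injOn_erase_star F v)

theorem sum_link (F : Finset (Finset α)) (v : α) :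
    ∑ A ∈ link F v, 1 / ((#A : ℝ) + 1) = weight F v := by
  rw [link, sum_image (injOn_erase_star F v), weight]
  refine sum_congr rfl fun H hH => ?_
  rw [mem_star] at hH
  rw [← card_erase_add_one hH.2]
  push_cast
  rfl

theorem mem_link {F : Finset (Finset α)} {v : α} {A : Finset α} :
    A ∈ link F v ↔ v ∉ A ∧ insert v A ∈ F := by
  rw [link, mem_image]
  constructor
  · rintro ⟨H, hH, rfl⟩
    rw [mem_star] at hH
    exact ⟨notMem_erase _ _, by rw [insert_erase hH.2]; exact hH.1⟩
  · rintro ⟨h1, h2⟩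
    exact ⟨insert v A, mem_star.2 ⟨h2, mem_insert_self _ _⟩, erase_insert h1⟩

theorem isLowerSet_link {F : Finset (Finset α)} (hF : IsLowerSet (F : Set (Finset α))) (v : α) :
    IsLowerSet (link F v : Set (Finset α)) := by
  intro A B hBA hA
  rw [mem_coe, mem_link] at hA ⊢
  exact ⟨fun h => hA.1 (hBA h), hF (insert_subset_insert v hBA) hA.2⟩

theorem weight_powerset {B : Finset α} {v : α} (hv : v ∈ B) :
    weight B.powerset v = ((2 : ℝ) ^ #B - 1) / #B := by
  have hl : link B.powerset v = (B.erase v).powerset := by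
    ext A
    rw [mem_link, mem_powerset, mem_powerset, insert_subset_iff, subset_erase]
    tauto
  have hc : #(B.erase v) + 1 = #B := card_erase_add_one hv
  rw [← sum_link, hl, ← hc]
  push_cast
  rw [← sum_choose_div, sum_powerset_apply_card (fun m => 1 / ((m : ℝ) + 1))]
  refine sum_congr rfl fun i _ => ?_
  rw [nsmul_eq_mul]; ring

section Neighbourhood

variable [Fintype α]

/-- The closed neighbourhood of `v` in the graph of the two-element members of `F`. -/
def nbhd (F : Finset (Finset α)) (v : α) : Finset α := univ.filter fun u => {v, u} ∈ F

theorem mem_nbhd {F : Finset (Finset α)} {v u : α} : u ∈ nbhd F v ↔ {v, u} ∈ F := by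
  simp [nbhd]

theorem subset_nbhd {F : Finset (Finset α)} (hF : IsLowerSet (F : Set (Finset α))) {v : α}
    {H : Finset α} (hH : H ∈ F) (hv : v ∈ H) : H ⊆ nbhd F v := by
  intro u hu
  rw [mem_nbhd]
  exact hF (insert_subset hv (singleton_subset_iff.2 hu)) hH

theorem card_star_le {F : Finset (Finset α)} (hF : IsLowerSet (F : Set (Finset α))) (v : α) :
    #(star F v) ≤ 2 ^ (#(nbhd F v) - 1) := by
  rcases (star F v).eq_empty_or_nonempty with h | ⟨H, hH⟩
  · simp [h]
  rw [mem_star] at hH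
  have hv : v ∈ nbhd F v := subset_nbhd hF hH.1 hH.2 hH.2
  rw [← card_erase_of_mem hv, ← card_powerset, ← card_link]
  refine card_le_card fun A hA => ?_
  rw [mem_link] at hA
  rw [mem_powerset, subset_erase]
  exact ⟨(subset_insert v A).trans (subset_nbhd hF hA.2 (mem_insert_self _ _)), hA.1⟩

end Neighbourhood

theorem two_pow_gt {m : ℕ} (hm : 10 ≤ m) : 20 * (m + 4) < 2 ^ m := by
  induction m, hm using Nat.le_induction with
  | base => norm_num
  | succ m hm ih => rw [pow_succ]; omega

/-! ### The members missing from the power set of a block -/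

/-- The complements in `B` of the subsets of `B` that do not belong to `F`. -/
def missing (F : Finset (Finset α)) (B : Finset α) : Finset (Finset α) :=
  B.powerset.filter fun D => B \ D ∉ F

theorem mem_missing {F : Finset (Finset α)} {B D : Finset α} :
    D ∈ missing F B ↔ D ⊆ B ∧ B \ D ∉ F := by
  rw [missing, mem_filter, mem_powerset]

theorem isLowerSet_missing {F : Finset (Finset α)} (hF : IsLowerSet (F : Set (Finset α)))
    (B : Finset α) : IsLowerSet (missing F B : Set (Finset α)) := by
  intro D E hED hD
  rw [mem_coe, mem_missing] at hD ⊢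
  exact ⟨le_trans hED hD.1, fun h => hD.2 (hF (sdiff_subset_sdiff le_rfl hED) h)⟩

/-- Complementation in `B` exchanges the subsets through `u` with those avoiding `u`, so missing
sets that avoid `u` measure its degree deficit inside `B`. -/
theorem card_star_filter_subset_add (F : Finset (Finset α)) {B : Finset α} {u : α} (hu : u ∈ B) :
    #(star (F.filter fun H => H ⊆ B) u) + #((missing F B).filter fun D => u ∉ D)
      = 2 ^ (#B - 1) := by
  rw [← card_erase_of_mem hu, ← card_powerset,
    ← card_filter_add_card_filter_not (s := (B.erase u).powerset) (fun D => B \ D ∈ F)]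
  congr 1
  · refine card_bij' (fun H _ => B \ H) (fun D _ => B \ D) ?_ ?_ ?_ ?_
    · intro H hH
      simp only [mem_star, mem_filter, mem_powerset] at hH ⊢
      rw [subset_erase, Finset.sdiff_sdiff_eq_self hH.1.2]
      exact ⟨⟨sdiff_subset, fun h => (mem_sdiff.1 h).2 hH.2⟩, hH.1.1⟩
    · intro D hD
      simp only [mem_star, mem_filter, mem_powerset, subset_erase] at hD ⊢
      exact ⟨⟨hD.2, sdiff_subset⟩, mem_sdiff.2 ⟨hu, hD.1.2⟩⟩
    · intro H hH
      simp only [mem_star, mem_filter] at hH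
      exact Finset.sdiff_sdiff_eq_self hH.1.2
    · intro D hD
      simp only [mem_filter, mem_powerset, subset_erase] at hD
      exact Finset.sdiff_sdiff_eq_self hD.1.1
  · congr 1
    ext D
    simp only [mem_filter, mem_missing, mem_powerset, subset_erase]
    tauto

theorem card_filter_subset_add (F : Finset (Finset α)) (B : Finset α) :
    #(F.filter fun H => H ⊆ B) + #(missing F B) = 2 ^ #B := by
  rw [← card_powerset, ← card_filter_add_card_filter_not (s := B.powerset) (fun D => B \ D ∈ F)]
  congr 1
  refine card_bij' (fun H _ => B \ H) (fun D _ => B \ D) ?_ ?_ ?_ ?_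
  · intro H hH
    simp only [mem_filter, mem_powerset] at hH ⊢
    rw [Finset.sdiff_sdiff_eq_self hH.2]
    exact ⟨sdiff_subset, hH.1⟩
  · intro D hD
    simp only [mem_filter, mem_powerset] at hD ⊢
    exact ⟨hD.2, sdiff_subset⟩
  · intro H hH
    exact Finset.sdiff_sdiff_eq_self (mem_filter.1 hH).2
  · intro D hD
    simp only [mem_filter, mem_powerset] at hD
    exact Finset.sdiff_sdiff_eq_self hD.1

/-- Each absent subset costs `u` at most weight one. The bound is crude, but is only used where some
vertex lies in several blocks and has weight to spare. -/
theorem weight_filter_subset_ge (F : Finset (Finset α)) {B : Finset α} {u : α} (hu : u ∈ B) :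
    ((2 : ℝ) ^ #B - 1) / #B - #(missing F B) ≤ weight (F.filter fun H => H ⊆ B) u := by
  rw [← weight_powerset hu, ← weight_filter_add_weight_filter_not B.powerset (fun H => H ∈ F)]
  have h1 : weight (B.powerset.filter fun H => H ∈ F) u ≤ weight (F.filter fun H => H ⊆ B) u := by
    refine weight_le_weight (fun H hH => ?_) u
    rw [mem_filter, mem_powerset] at hH
    exact mem_filter.2 ⟨hH.2, hH.1⟩
  have h2 : weight (B.powerset.filter fun H => ¬ H ∈ F) u ≤ #(missing F B) := by
    have h3 : #(star (B.powerset.filter fun H => ¬ H ∈ F) u) ≤ #(missing F B) := by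
      refine card_le_card_of_injOn (fun H => B \ H) ?_ ?_
      · intro H hH
        simp only [mem_coe, mem_star, mem_filter, mem_powerset, mem_missing] at hH ⊢
        rw [Finset.sdiff_sdiff_eq_self hH.1.1]
        exact ⟨sdiff_subset, hH.1.2⟩
      · intro H hH H' hH' h
        simp only [mem_coe, mem_star, mem_filter, mem_powerset] at hH hH'
        rw [← Finset.sdiff_sdiff_eq_self hH.1.1, ← Finset.sdiff_sdiff_eq_self hH'.1.1]
        exact congrArg (B \ ·) h
    have h4 : weight (B.powerset.filter fun H => ¬ H ∈ F) u
        ≤ #(star (B.powerset.filter fun H => ¬ H ∈ F) u) := by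
      rw [weight, card_eq_sum_ones, Nat.cast_sum]
      refine sum_le_sum fun H hH => ?_
      have : (1 : ℝ) ≤ #H := by
        exact_mod_cast card_pos.2 ⟨u, (mem_star.1 hH).2⟩
      rw [Nat.cast_one]
      exact div_le_one_of_le₀ this (by positivity)
    have h5 : (#(star (B.powerset.filter fun H => ¬ H ∈ F) u) : ℝ) ≤ #(missing F B) := by
      exact_mod_cast h3
    linarith
  linarith

/-! ### The weight outside a block -/

theorem half_le_weight_filter_not_subset {F : Finset (Finset α)} {B : Finset α} {u y : α}
    (hu : u ∈ B) (hy : y ∉ B) (huy : {u, y} ∈ F) :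
    1 / 2 ≤ weight (F.filter fun H => ¬ H ⊆ B) u := by
  have hne : u ≠ y := fun h => hy (h ▸ hu)
  have hmem : ({u, y} : Finset α) ∈ star (F.filter fun H => ¬ H ⊆ B) u := by
    rw [mem_star, mem_filter]
    exact ⟨⟨huy, fun h => hy (h (by simp))⟩, by simp⟩
  have := single_le_sum (f := fun H : Finset α => 1 / (#H : ℝ)) (fun _ _ => by positivity) hmem
  rw [weight]
  simpa [card_pair hne] using this

/-- A member of size at least four leaving `B` contains `u`, some `x` outside `B` and two more
elements; its subsets through `u` and `x` give `1/2 + 1/3 + 1/3 + 1/4`. If all sizes are at most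
three, `{u, y}` and three others give `1/2 + 3 * (1/3)`. -/
theorem weight_filter_not_subset_ge_of_four_le {F : Finset (Finset α)}
    (hF : IsLowerSet (F : Set (Finset α))) {B : Finset α} {u y : α}
    (hu : u ∈ B) (hy : y ∉ B) (huy : {u, y} ∈ F)
    (h4 : 4 ≤ #(star (F.filter fun H => ¬ H ⊆ B) u)) :
    17 / 12 ≤ weight (F.filter fun H => ¬ H ⊆ B) u := by
  have hmem : ∀ H : Finset α, H ∈ star (F.filter fun H => ¬ H ⊆ B) u ↔
      (H ∈ F ∧ ¬ H ⊆ B) ∧ u ∈ H := fun H => by rw [mem_star, mem_filter]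
  by_cases hbig : ∃ H ∈ star (F.filter fun H => ¬ H ⊆ B) u, 4 ≤ #H
  · obtain ⟨H, hH, hH4⟩ := hbig
    rw [hmem] at hH
    obtain ⟨⟨hHF, hHB⟩, huH⟩ := hH
    obtain ⟨x, hxH, hxB⟩ := not_subset.1 hHB
    have hux : u ≠ x := fun h => hxB (h ▸ hu)
    have hrest : 2 ≤ #((H.erase u).erase x) := by
      rw [card_erase_of_mem (mem_erase.2 ⟨hux.symm, hxH⟩), card_erase_of_mem huH]; omega
    obtain ⟨z, hz, w, hw, hzw⟩ := one_lt_card.1 hrest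
    simp only [mem_erase] at hz hw
    have hsub : ∀ S : Finset α, u ∈ S → x ∈ S → S ⊆ H →
        S ∈ star (F.filter fun H => ¬ H ⊆ B) u := fun S h1 h2 h3 =>
      (hmem S).2 ⟨⟨hF h3 hHF, fun h => hxB (h h2)⟩, h1⟩
    have c2 : #({u, x} : Finset α) = 2 := card_pair hux
    have c3 : #({u, x, z} : Finset α) = 3 := card_eq_three.2
      ⟨u, x, z, hux, hz.2.1.symm, hz.1.symm, rfl⟩
    have c3' : #({u, x, w} : Finset α) = 3 := card_eq_three.2
      ⟨u, x, w, hux, hw.2.1.symm, hw.1.symm, rfl⟩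
    have c4 : #({u, x, z, w} : Finset α) = 4 := by
      rw [card_insert_of_notMem, card_eq_three.2 ⟨x, z, w, hz.1.symm, hw.1.symm, hzw, rfl⟩]
      simp only [mem_insert, mem_singleton, not_or]
      exact ⟨hux, hz.2.1.symm, hw.2.1.symm⟩
    have hne : ({u, x, z} : Finset α) ≠ {u, x, w} := by
      intro h
      have : z ∈ ({u, x, w} : Finset α) := h ▸ (by simp)
      simp only [mem_insert, mem_singleton] at this
      rcases this with h | h | h
      · exact hz.2.1 h
      · exact hz.1 h
      · exact hzw h
    have hsum : ∑ S ∈ ({{u, x}, {u, x, z}, {u, x, w}, {u, x, z, w}} : Finset (Finset α)),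
        1 / (#S : ℝ) = 17 / 12 := by
      rw [sum_insert, sum_insert, sum_insert, sum_singleton, c2, c3, c3', c4]
      · norm_num
      · simp only [mem_singleton]
        intro h; rw [h] at c3'; omega
      · simp only [mem_insert, mem_singleton, not_or]
        exact ⟨hne, fun h => by rw [h] at c3; omega⟩
      · simp only [mem_insert, mem_singleton, not_or]
        exact ⟨fun h => by rw [h] at c2; omega, fun h => by rw [h] at c2; omega,
          fun h => by rw [h] at c2; omega⟩
    rw [← hsum, weight]
    refine sum_le_sum_of_subset_of_nonneg ?_ fun _ _ _ => by positivity
    intro S hS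
    simp only [mem_insert, mem_singleton] at hS
    rcases hS with rfl | rfl | rfl | rfl <;>
    · refine hsub _ (by simp) (by simp) ?_
      simp [insert_subset_iff, huH, hxH, hz.2.2, hw.2.2]
  · push Not at hbig
    have hne : u ≠ y := fun h => hy (h ▸ hu)
    have hp : ({u, y} : Finset α) ∈ star (F.filter fun H => ¬ H ⊆ B) u :=
      (hmem _).2 ⟨⟨huy, fun h => hy (h (by simp))⟩, by simp⟩
    rw [weight, ← add_sum_erase _ _ hp, card_pair hne]
    have h1 := card_nsmul_le_sum ((star (F.filter fun H => ¬ H ⊆ B) u).erase {u, y})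
      (fun H => 1 / (#H : ℝ)) (1 / 3) fun H hH => by
        have hH' := mem_of_mem_erase hH
        have h2 : 0 < #H := card_pos.2 ⟨u, ((hmem H).1 hH').2⟩
        have h3 : #H ≤ 3 := by have := hbig H hH'; omega
        have h3' : (#H : ℝ) ≤ 3 := by exact_mod_cast h3
        have h2' : (0 : ℝ) < #H := by exact_mod_cast h2
        exact one_div_le_one_div_of_le h2' h3'
    rw [nsmul_eq_mul] at h1
    have h5 : 3 ≤ #((star (F.filter fun H => ¬ H ⊆ B) u).erase {u, y}) := by
      rw [card_erase_of_mem hp]; omega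
    have h6 : (3 : ℝ) ≤ #((star (F.filter fun H => ¬ H ⊆ B) u).erase {u, y}) := by
      exact_mod_cast h5
    push_cast
    linarith

end TraceSets

/-! ### Dense down-sets and their blocks -/

namespace TraceSets

open Finset

/-- A down-set in which every vertex has degree at least `2 ^ (d - 1) - c + 1`. -/
structure IsDense {n : ℕ} (F : Finset (Finset (Fin n))) (d c : ℕ) : Prop where
  lower : IsLowerSet (F : Set (Finset (Fin n)))
  fifty_le : 50 ≤ d
  one_le : 1 ≤ c
  le : c ≤ d
  degree : ∀ v, 2 ^ (d - 1) + 1 ≤ #(star F v) + c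

namespace IsDense

variable {n d c : ℕ} {F : Finset (Finset (Fin n))}

theorem two_pow_gt (hF : IsDense F d c) : 2 * d < 2 ^ (d - 3) := by
  have h := TraceSets.two_pow_gt (m := d - 3) (by have := hF.fifty_le; omega)
  omega

theorem two_pow_sub_one (hF : IsDense F d c) : 2 ^ (d - 1) = 4 * 2 ^ (d - 3) := by
  have := hF.fifty_le
  rw [show d - 1 = d - 3 + 2 by omega, pow_add]; ring

theorem singleton_mem (hF : IsDense F d c) (v : Fin n) : {v} ∈ F := by
  have h1 := hF.degree v
  have h2 := hF.two_pow_gt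
  have h3 := hF.two_pow_sub_one
  have h4 := hF.le
  obtain ⟨H, hH⟩ : (star F v).Nonempty := card_pos.1 (by omega)
  rw [mem_star] at hH
  exact hF.lower (singleton_subset_iff.2 hH.2) hH.1

theorem self_mem_nbhd (hF : IsDense F d c) (v : Fin n) : v ∈ nbhd F v := by
  rw [mem_nbhd, pair_eq_singleton]; exact hF.singleton_mem v

theorem le_card_nbhd (hF : IsDense F d c) (v : Fin n) : d ≤ #(nbhd F v) := by
  by_contra! hlt
  have h1 := hF.degree v
  have h2 := card_star_le hF.lower v
  have h3 : 2 ^ (#(nbhd F v) - 1) ≤ 2 ^ (d - 2) := Nat.pow_le_pow_right (by norm_num) (by omega)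
  have h4 := hF.two_pow_gt
  have h5 := hF.fifty_le
  have h6 : 2 ^ (d - 2) = 2 * 2 ^ (d - 3) := by
    rw [show d - 2 = d - 3 + 1 by omega, pow_succ]; ring
  have h7 := hF.two_pow_sub_one
  have := hF.le
  omega

/-- Vertices with more than `d - 1` neighbours have large weight. -/
theorem weight_ge_of_lt_card_nbhd (hF : IsDense F d c) {v : Fin n} (hv : d < #(nbhd F v)) :
    ((2 : ℝ) ^ d - c) / d ≤ weight F v := by
  have hd := hF.fifty_le
  have hone : d - 1 + 1 ≤ #((link F v) # 1) := by
    have h1 : #((nbhd F v).erase v) ≤ #((link F v) # 1) := by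
      refine card_le_card_of_injOn (fun u => {u}) ?_ (singleton_injective.injOn)
      intro u hu
      rw [mem_coe, mem_erase, mem_nbhd] at hu
      rw [mem_coe, mem_slice, mem_link]
      exact ⟨⟨by simpa using hu.1.symm, hu.2⟩, rfl⟩
    rw [card_erase_of_mem (hF.self_mem_nbhd v)] at h1
    omega
  have h := weight_ge_of_card_slice_one_gt (link F v) (isLowerSet_link hF.lower v)
    (k := d - 1) (c := c) (by omega) hF.one_le (by have := hF.le; omega)
    (by rw [card_link]; exact hF.degree v) hone
  rw [sum_link, Nat.sub_add_cancel (by omega), Nat.cast_sub (by omega)] at h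
  simpa using h

/-! ### Blocks -/

/-- A block is a closed neighbourhood of the least possible size. -/
def _root_.TraceSets.IsBlock {n : ℕ} (F : Finset (Finset (Fin n))) (d : ℕ)
    (B : Finset (Fin n)) : Prop := #B = d ∧ ∃ v, nbhd F v = B

/-- All members through `v` lie inside its neighbourhood, so the missing sets avoiding `v` count
exactly its degree deficit. -/
theorem card_missing_filter (hF : IsDense F d c) {v : Fin n} (hv : #(nbhd F v) = d) :
    #((missing F (nbhd F v)).filter fun D => v ∉ D) + 1 ≤ c := by
  have h1 := card_star_filter_subset_add F (hF.self_mem_nbhd v)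
  have h2 : star (F.filter fun H => H ⊆ nbhd F v) v = star F v := by
    ext H
    simp only [mem_star, mem_filter]
    exact ⟨fun h => ⟨h.1.1, h.2⟩, fun h => ⟨⟨h.1, subset_nbhd hF.lower h.1 h.2⟩, h.2⟩⟩
  have h3 := hF.degree v
  rw [h2, hv] at h1
  omega

theorem card_missing (hF : IsDense F d c) {B : Finset (Fin n)} (hB : IsBlock F d B) :
    #(missing F B) + 2 ≤ 2 * c := by
  obtain ⟨hBd, v, rfl⟩ := hB
  have h1 := hF.card_missing_filter hBd
  have h2 := card_filter_mem_le_card_filter_notMem (isLowerSet_missing hF.lower (nbhd F v)) v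
  have h3 := card_filter_mem_add_card_filter_notMem (missing F (nbhd F v)) v
  omega

/-- Blocks are cliques: if `{x, y}` were absent, so would be every set containing `v`, `x`, `y`, at
least `2 ^ (d - 3)` subsets of the block through its centre `v`, far more than `c - 1`. -/
theorem pair_mem (hF : IsDense F d c) {B : Finset (Fin n)} (hB : IsBlock F d B) {x y : Fin n}
    (hx : x ∈ B) (hy : y ∈ B) : {x, y} ∈ F := by
  obtain ⟨hBd, v, rfl⟩ := hB
  by_contra hxy
  set S : Finset (Fin n) := {v, x, y} with hS
  have hSB : S ⊆ nbhd F v := by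
    simp [hS, insert_subset_iff, hx, hy, hF.self_mem_nbhd v]
  have hSF : S ∉ F := fun h => hxy (hF.lower (subset_insert v _) h)
  have hmiss : nbhd F v \ S ∈ missing F (nbhd F v) := by
    rw [mem_missing, Finset.sdiff_sdiff_eq_self hSB]
    exact ⟨sdiff_subset, hSF⟩
  have h1 : (nbhd F v \ S).powerset ⊆ (missing F (nbhd F v)).filter fun D => v ∉ D := by
    intro D hD
    rw [mem_powerset] at hD
    rw [mem_filter]
    exact ⟨isLowerSet_missing hF.lower _ hD hmiss,
      fun h => (mem_sdiff.1 (hD h)).2 (mem_insert_self _ _)⟩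
  have h2 := card_le_card h1
  have h3 := hF.card_missing_filter hBd
  have h4 : d - 3 ≤ #(nbhd F v \ S) := by
    rw [card_sdiff_of_subset hSB, hBd]
    have : #S ≤ 3 := card_le_three
    omega
  have h5 : 2 ^ (d - 3) ≤ 2 ^ #(nbhd F v \ S) := Nat.pow_le_pow_right (by norm_num) h4
  rw [card_powerset] at h2
  have h6 := hF.two_pow_gt
  have h7 := hF.le
  omega

theorem block_subset_nbhd (hF : IsDense F d c) {B : Finset (Fin n)} (hB : IsBlock F d B)
    {x : Fin n} (hx : x ∈ B) : B ⊆ nbhd F x := fun _ hy => mem_nbhd.2 (hF.pair_mem hB hx hy)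

/-- Hence a vertex with a smallest neighbourhood lies in just one block, which keeps the cores of
different blocks disjoint. -/
theorem nbhd_eq_block (hF : IsDense F d c) {B : Finset (Fin n)} (hB : IsBlock F d B)
    {x : Fin n} (hx : x ∈ B) (hxd : #(nbhd F x) = d) : nbhd F x = B :=
  (eq_of_subset_of_card_le (hF.block_subset_nbhd hB hx) (by rw [hxd, hB.1])).symm

theorem exists_notMem_block (hF : IsDense F d c) {B : Finset (Fin n)} (hB : IsBlock F d B)
    {x : Fin n} (hxd : #(nbhd F x) ≠ d) : ∃ y, y ∉ B ∧ {x, y} ∈ F := by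
  have h1 : ¬ nbhd F x ⊆ B := by
    intro h
    have h2 := card_le_card h
    have h3 := hF.le_card_nbhd x
    have h4 := hB.1
    omega
  obtain ⟨y, hy, hyB⟩ := not_subset.1 h1
  exact ⟨y, hyB, mem_nbhd.1 hy⟩

theorem empty_mem (hF : IsDense F d c) (v : Fin n) : ∅ ∈ F :=
  hF.lower (empty_subset _) (hF.singleton_mem v)

/-- The total weight on a block is at least that of an optimal separate block. -/
theorem sum_block_weight_ge (hF : IsDense F d c) {B : Finset (Fin n)} (hB : IsBlock F d B) :
    (2 : ℝ) ^ d - blockLoss d c ≤ ∑ u ∈ B, weight F u := by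
  obtain ⟨hBd, v, hvB⟩ := hB
  have hB : IsBlock F d B := ⟨hBd, v, hvB⟩
  have hin : ∑ u ∈ B, weight (F.filter fun H => H ⊆ B) u = (2 : ℝ) ^ d - #(missing F B) - 1 := by
    rw [sum_weight (fun H hH => (mem_filter.1 hH).2)
      (mem_filter.2 ⟨hF.empty_mem v, empty_subset _⟩)]
    have h := card_filter_subset_add F B
    rw [hBd] at h
    have h' : (#(F.filter fun H => H ⊆ B) : ℝ) + #(missing F B) = 2 ^ d := by exact_mod_cast h
    linarith
  have hvB' : v ∈ B := hvB ▸ hF.self_mem_nbhd v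
  set G := B.filter fun u => #(nbhd F u) = d with hG
  have hbad : ∀ u ∈ B \ G, u ∈ B ∧ ∃ y, y ∉ B ∧ {u, y} ∈ F := by
    intro u hu
    rw [hG, mem_sdiff, mem_filter] at hu
    exact ⟨hu.1, hF.exists_notMem_block hB fun h => hu.2 ⟨hu.1, h⟩⟩
  have hmain := card_le_blockLoss_add_sum (B := B) (G := G) (𝒟 := missing F B)
    (ω := weight (F.filter fun H => ¬ H ⊆ B)) hBd hF.fifty_le hF.le (filter_subset _ _)
    ⟨v, mem_filter.2 ⟨hvB', by rw [hvB, hBd]⟩⟩ (isLowerSet_missing hF.lower B)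
    (fun u hu => by
      rw [hG, mem_filter] at hu
      have h := hF.card_missing_filter hu.2
      rwa [hF.nbhd_eq_block hB hu.1 hu.2] at h)
    (fun u hu => by
      obtain ⟨h1, y, h2, h3⟩ := hbad u hu
      exact half_le_weight_filter_not_subset h1 h2 h3)
    -- With `c + 3` missing sets avoiding `u`, at most `2 ^ (d - 1) - c - 3` members through `u`
    -- stay in `B`, so the degree condition sends at least four outside.
    (fun u hu hc => by
      obtain ⟨h1, y, h2, h3⟩ := hbad u hu
      refine weight_filter_not_subset_ge_of_four_le hF.lower h1 h2 h3 ?_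
      have h4 := card_star_filter_subset_add F h1
      have h5 := hF.degree u
      have h6 : #(star (F.filter fun H => H ⊆ B) u) + #(star (F.filter fun H => ¬ H ⊆ B) u)
          = #(star F u) := by
        rw [star, star, filter_comm, filter_comm (p := fun H => ¬ H ⊆ B)]
        exact card_filter_add_card_filter_not _
      rw [hBd] at h4
      omega)
  have hout : ∑ u ∈ B \ G, weight (F.filter fun H => ¬ H ⊆ B) u
      ≤ ∑ u ∈ B, weight (F.filter fun H => ¬ H ⊆ B) u :=
    sum_le_sum_of_subset_of_nonneg sdiff_subset fun u _ _ => weight_nonneg _ _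
  have hsplit : ∑ u ∈ B, weight F u = ∑ u ∈ B, weight (F.filter fun H => H ⊆ B) u
      + ∑ u ∈ B, weight (F.filter fun H => ¬ H ⊆ B) u := by
    rw [← sum_add_distrib]
    exact sum_congr rfl fun u _ => (weight_filter_add_weight_filter_not F _ u).symm
  linarith

/-! ### Vertices in several blocks -/

/-- The members inside the block `B` that contain a vertex whose neighbourhood is `B`. -/
def _root_.TraceSets.blockCore {n : ℕ} (F : Finset (Finset (Fin n))) (B : Finset (Fin n)) :
    Finset (Finset (Fin n)) := F.filter fun H => H ⊆ B ∧ ∃ v ∈ H, nbhd F v = B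

/-- The centre `v` of `B'` differs from `u`, since `u` lies in two blocks. Of the `2 ^ (d - 2)`
subsets of `B'` through both, at most `c - 1` are absent. -/
theorem card_star_blockCore (hF : IsDense F d c) {B B' : Finset (Fin n)} (hB : IsBlock F d B)
    (hB' : IsBlock F d B') (hne : B' ≠ B) {u : Fin n} (hu : u ∈ B) (hu' : u ∈ B') :
    2 ^ (d - 2) + 1 ≤ #(star (blockCore F B') u) + c := by
  obtain ⟨hBd', v, rfl⟩ := hB'
  have huv : v ≠ u := by
    rintro rfl
    exact hne (hF.nbhd_eq_block hB hu hBd')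
  have hv := hF.self_mem_nbhd v
  have h1 : #(((nbhd F v).erase u).erase v).powerset = 2 ^ (d - 2) := by
    rw [card_powerset, card_erase_of_mem (mem_erase.2 ⟨huv, hv⟩), card_erase_of_mem hu', hBd']
    rfl
  rw [← card_filter_add_card_filter_not (fun D => nbhd F v \ D ∈ F)] at h1
  have h2 : #((((nbhd F v).erase u).erase v).powerset.filter fun D => nbhd F v \ D ∈ F)
      ≤ #(star (blockCore F (nbhd F v)) u) := by
    refine card_le_card_of_injOn (fun D => nbhd F v \ D) ?_ ?_
    · intro D hD
      simp only [mem_coe, mem_filter, mem_powerset, subset_erase] at hD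
      simp only [mem_coe, mem_star, blockCore, mem_filter]
      exact ⟨⟨hD.2, sdiff_subset, v, mem_sdiff.2 ⟨hv, hD.1.2⟩, rfl⟩,
        mem_sdiff.2 ⟨hu', hD.1.1.2⟩⟩
    · intro D hD E hE h
      simp only [mem_coe, mem_filter, mem_powerset, subset_erase] at hD hE
      rw [← Finset.sdiff_sdiff_eq_self hD.1.1.1, ← Finset.sdiff_sdiff_eq_self hE.1.1.1]
      exact congrArg (nbhd F v \ ·) h
  have h3 : #((((nbhd F v).erase u).erase v).powerset.filter fun D => ¬ nbhd F v \ D ∈ F)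
      ≤ #((missing F (nbhd F v)).filter fun D => v ∉ D) := by
    refine card_le_card fun D hD => ?_
    simp only [mem_filter, mem_powerset, subset_erase, mem_missing] at hD ⊢
    exact ⟨⟨hD.1.1.1, hD.2⟩, hD.1.2⟩
  have h4 := hF.card_missing_filter hBd'
  omega

/-- The cores of the other blocks through `u` are disjoint from each other and from the members
inside `B`, so each adds its own exponentially large weight. -/
theorem weight_ge_of_mem_blocks (hF : IsDense F d c) {𝔅 : Finset (Finset (Fin n))}
    (h𝔅 : ∀ B ∈ 𝔅, IsBlock F d B) {B : Finset (Fin n)} (hB : B ∈ 𝔅) {u : Fin n} (hu : u ∈ B) :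
    ((2 : ℝ) ^ d - 1) / d - 2 * (c - 1)
      + (#(𝔅.filter fun B' => u ∈ B') - 1) * (((2 : ℝ) ^ (d - 2) - d) / d) ≤ weight F u := by
  have hd : (50 : ℝ) ≤ d := by exact_mod_cast hF.fifty_le
  have hcd : (c : ℝ) ≤ d := by exact_mod_cast hF.le
  have hBu : B ∈ 𝔅.filter fun B' => u ∈ B' := mem_filter.2 ⟨hB, hu⟩
  rw [← weight_filter_add_weight_filter_not F (fun H => H ⊆ B) u]
  have hin : ((2 : ℝ) ^ d - 1) / d - 2 * (c - 1) ≤ weight (F.filter fun H => H ⊆ B) u := by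
    have h1 := weight_filter_subset_ge F hu
    have h2 := hF.card_missing (h𝔅 B hB)
    have h3 : (#(missing F B) : ℝ) + 2 ≤ 2 * c := by exact_mod_cast h2
    rw [(h𝔅 B hB).1] at h1
    linarith
  set 𝔅' := (𝔅.filter fun B' => u ∈ B').erase B with h𝔅'
  have hmem : ∀ B' ∈ 𝔅', IsBlock F d B' ∧ B' ≠ B ∧ u ∈ B' := by
    intro B' h
    rw [h𝔅', mem_erase, mem_filter] at h
    exact ⟨h𝔅 B' h.2.1, h.1, h.2.2⟩
  have hdisj : (𝔅' : Set (Finset (Fin n))).PairwiseDisjoint fun B' => star (blockCore F B') u := by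
    intro B₁ h₁ B₂ h₂ hne
    rw [Function.onFun, disjoint_left]
    intro H hH₁ hH₂
    simp only [mem_star, blockCore, mem_filter] at hH₁ hH₂
    obtain ⟨v, hv, hvB⟩ := hH₁.1.2.2
    have hb₁ := (hmem B₁ h₁).1
    have := hF.nbhd_eq_block (hmem B₂ h₂).1 (hH₂.1.2.1 hv) (by rw [hvB, hb₁.1])
    exact hne (hvB.symm.trans this)
  have hsub : (𝔅'.biUnion fun B' => star (blockCore F B') u)
      ⊆ star (F.filter fun H => ¬ H ⊆ B) u := by
    intro H hH
    obtain ⟨B', hB', hH'⟩ := mem_biUnion.1 hH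
    simp only [mem_star, blockCore, mem_filter] at hH' ⊢
    refine ⟨⟨hH'.1.1, fun hHB => ?_⟩, hH'.2⟩
    obtain ⟨v, hv, hvB⟩ := hH'.1.2.2
    have hb' := (hmem B' hB').1
    have := hF.nbhd_eq_block (h𝔅 B hB) (hHB hv) (by rw [hvB, hb'.1])
    exact (hmem B' hB').2.1 (hvB.symm.trans this)
  have hout : (#𝔅' : ℝ) * (((2 : ℝ) ^ (d - 2) - d) / d) ≤ weight (F.filter fun H => ¬ H ⊆ B) u := by
    have h1 := sum_le_sum_of_subset_of_nonneg (f := fun H : Finset (Fin n) => 1 / (#H : ℝ)) hsub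
      fun _ _ _ => by positivity
    rw [sum_biUnion hdisj] at h1
    refine le_trans ?_ h1
    rw [← nsmul_eq_mul]
    refine card_nsmul_le_sum _ _ _ fun B' hB' => ?_
    obtain ⟨hb', hne, hu'⟩ := hmem B' hB'
    have h2 := hF.card_star_blockCore (h𝔅 B hB) hb' hne hu hu'
    have h3 : (2 : ℝ) ^ (d - 2) + 1 ≤ #(star (blockCore F B') u) + c := by exact_mod_cast h2
    have h4 := card_div_le_weight (F := blockCore F B') (v := u) (d := d) fun H hH => by
      rw [← hb'.1]
      exact card_le_card (mem_filter.1 hH).2.1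
    refine le_trans ?_ h4
    gcongr
    linarith
  have hcard : (#𝔅' : ℝ) = #(𝔅.filter fun B' => u ∈ B') - 1 := by
    rw [h𝔅', card_erase_of_mem hBu, Nat.cast_sub (card_pos.2 ⟨_, hBu⟩)]
    simp
  rw [hcard] at hout
  linarith

theorem _root_.TraceSets.cube_le_two_pow {m : ℕ} (hm : 48 ≤ m) :
    8 * (m + 2) ^ 3 + (m + 2) ≤ 2 ^ m := by
  induction m, hm using Nat.le_induction with
  | base => norm_num
  | succ m hm ih =>
    have h1 : (m + 1 + 2) ^ 3 ≤ 2 * (m + 2) ^ 3 := by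
      obtain ⟨e, rfl⟩ := Nat.exists_eq_add_of_le hm
      ring_nf
      linarith [Nat.zero_le (e ^ 2), Nat.zero_le (e ^ 3)]
    rw [pow_succ 2]
    linarith

/-- Distributing the weights over the blocks: the average weight of a vertex of a dense down-set is
at least that of an optimal block. -/
theorem mul_div_le_card_sub_one (hF : IsDense F d c) (hn : 0 < n) :
    (n : ℝ) * (((2 : ℝ) ^ d - blockLoss d c) / d) ≤ #F - 1 := by
  have hd : (50 : ℝ) ≤ d := by exact_mod_cast hF.fifty_le
  have hc : (1 : ℝ) ≤ c := by exact_mod_cast hF.one_le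
  have hcd : (c : ℝ) ≤ d := by exact_mod_cast hF.le
  have hloss := le_blockLoss d c
  set T := ((2 : ℝ) ^ d - blockLoss d c) / d with hT
  rw [← sum_weight (B := univ) (fun H _ => subset_univ H) (hF.empty_mem ⟨0, hn⟩)]
  have hconst : (n : ℝ) * T = ∑ _v : Fin n, T := by simp
  rw [hconst, ← sub_nonneg, ← sum_sub_distrib]
  classical
  set 𝔅 : Finset (Finset (Fin n)) := univ.filter fun B => IsBlock F d B with h𝔅def
  have h𝔅 : ∀ B ∈ 𝔅, IsBlock F d B := fun B hB => (mem_filter.1 hB).2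
  set t : Fin n → ℕ := fun u => #(𝔅.filter fun B => u ∈ B) with ht
  have hzero : ∀ u, t u = 0 → 0 ≤ weight F u - T := by
    intro u hu
    have h1 : d < #(nbhd F u) := by
      refine lt_of_le_of_ne (hF.le_card_nbhd u) fun h => ?_
      have h2 : nbhd F u ∈ 𝔅.filter fun B => u ∈ B :=
        mem_filter.2 ⟨mem_filter.2 ⟨mem_univ _, h.symm, u, rfl⟩, hF.self_mem_nbhd u⟩
      exact absurd (card_pos.2 ⟨_, h2⟩) (by simp only [ht] at hu; omega)
    have h2 := hF.weight_ge_of_lt_card_nbhd h1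
    have h3 : T ≤ ((2 : ℝ) ^ d - c) / d := by rw [hT]; gcongr
    linarith
  have hlow : ∀ B ∈ 𝔅, ∀ u ∈ B, 1 ≤ t u ∧ -(2 * (d : ℝ))
      + (t u - 1) * (((2 : ℝ) ^ (d - 2) - d) / d) ≤ weight F u - T := by
    intro B hB u hu
    have h1 := hF.weight_ge_of_mem_blocks h𝔅 hB hu
    have h2 : T ≤ ((2 : ℝ) ^ d - 1) / d := by rw [hT]; gcongr; linarith
    exact ⟨card_pos.2 ⟨B, mem_filter.2 ⟨hB, hu⟩⟩, by simp only [ht]; linarith⟩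
  have hexp : 8 * (d : ℝ) ^ 2 ≤ ((2 : ℝ) ^ (d - 2) - d) / d := by
    rw [le_div_iff₀ (by linarith)]
    have h := cube_le_two_pow (m := d - 2) (by have := hF.fifty_le; omega)
    rw [Nat.sub_add_cancel (by have := hF.fifty_le; omega)] at h
    have h' : 8 * (d : ℝ) ^ 3 + d ≤ 2 ^ (d - 2) := by exact_mod_cast h
    nlinarith
  -- Each vertex shares its surplus equally among its `t u` blocks. One vertex with `t u ≥ 2` brings
  -- at least `2 * d ^ 2`, while each of the other `d - 1` vertices loses at most `2 * d`.
  have hblock : ∀ B ∈ 𝔅, 0 ≤ ∑ u ∈ B, (weight F u - T) / t u := by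
    intro B hB
    by_cases hall : ∀ u ∈ B, t u = 1
    · rw [sum_congr rfl (g := fun u => weight F u - T) fun u hu => by rw [hall u hu]; simp]
      rw [sum_sub_distrib, sum_const, (h𝔅 B hB).1, nsmul_eq_mul, hT]
      have h1 := hF.sum_block_weight_ge (h𝔅 B hB)
      rw [mul_div_cancel₀ _ (by linarith)]
      linarith
    · push Not at hall
      obtain ⟨u₀, hu₀, ht₀⟩ := hall
      rw [← add_sum_erase _ _ hu₀]
      have h1 : ∀ u ∈ B.erase u₀, -(2 * (d : ℝ)) ≤ (weight F u - T) / t u := by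
        intro u hu
        obtain ⟨h2, h3⟩ := hlow B hB u (mem_of_mem_erase hu)
        have h2' : (1 : ℝ) ≤ t u := by exact_mod_cast h2
        rw [le_div_iff₀ (by linarith)]
        have h4 : 0 ≤ ((t u : ℝ) - 1) * (((2 : ℝ) ^ (d - 2) - d) / d) :=
          mul_nonneg (by linarith) (by nlinarith)
        nlinarith
      have h5 := card_nsmul_le_sum _ _ _ h1
      rw [card_erase_of_mem hu₀, (h𝔅 B hB).1, nsmul_eq_mul,
        Nat.cast_sub (by have := hF.fifty_le; omega)] at h5
      have h6 : 2 * (d : ℝ) ^ 2 ≤ (weight F u₀ - T) / t u₀ := by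
        obtain ⟨h2, h3⟩ := hlow B hB u₀ hu₀
        have h2' : (2 : ℝ) ≤ t u₀ := by
          have : 2 ≤ t u₀ := by omega
          exact_mod_cast this
        rw [le_div_iff₀ (by linarith)]
        have h4 : ((t u₀ : ℝ) - 1) * (8 * (d : ℝ) ^ 2)
            ≤ ((t u₀ : ℝ) - 1) * (((2 : ℝ) ^ (d - 2) - d) / d) :=
          mul_le_mul_of_nonneg_left hexp (by linarith)
        nlinarith [mul_nonneg (sub_nonneg.2 h2') (sq_nonneg (d : ℝ))]
      push_cast at h5
      nlinarith
  have hdist : ∑ u, (if t u = 0 then 0 else weight F u - T)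
      = ∑ B ∈ 𝔅, ∑ u ∈ B, (weight F u - T) / t u := by
    have h1 : ∀ B ∈ 𝔅, ∑ u ∈ B, (weight F u - T) / t u
        = ∑ u, if u ∈ B then (weight F u - T) / t u else 0 := fun B _ => by
      rw [← sum_filter, filter_mem_eq_inter, univ_inter]
    rw [sum_congr rfl h1, sum_comm]
    refine sum_congr rfl fun u _ => ?_
    rw [← sum_filter, sum_const, nsmul_eq_mul]
    change _ = (t u : ℝ) * _
    split_ifs with h
    · simp [h]
    · have : (t u : ℝ) ≠ 0 := by exact_mod_cast h
      field_simp
  have hle : ∑ u, (if t u = 0 then 0 else weight F u - T) ≤ ∑ u, (weight F u - T) := by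
    refine sum_le_sum fun u _ => ?_
    split_ifs with h
    · exact hzero u h
    · exact le_rfl
  rw [hdist] at hle
  exact (sum_nonneg hblock).trans hle

end IsDense

end TraceSets

namespace TraceSets

open Finset
open scoped FinsetFamily

/-! ### Compression to a down-set -/

section Compression

variable {α : Type*} [DecidableEq α]

/-- Since `𝓓 a` preserves cardinality, this shows that compressing does not enlarge any trace. -/
theorem familyTrace_compression_subset (a : α) (F : Finset (Finset α)) (T : Finset α) :
    familyTrace (𝓓 a F) T ⊆ 𝓓 a (familyTrace F T) := by
  intro S hS
  obtain ⟨A, hA, rfl⟩ := mem_image.1 hS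
  have hmem : ∀ C ∈ F, C ∩ T ∈ familyTrace F T := fun C hC => mem_image_of_mem _ hC
  rw [Down.mem_compression] at hA ⊢
  rcases hA with ⟨hA, hA'⟩ | ⟨hA, hA'⟩
  · left
    refine ⟨hmem _ hA, ?_⟩
    rw [← erase_inter]
    exact hmem _ hA'
  · have haA : a ∉ A := fun h => hA (by rwa [insert_eq_of_mem h] at hA')
    have haT : a ∉ A ∩ T := fun h => haA (mem_inter.1 h).1
    by_cases hmemT : A ∩ T ∈ familyTrace F T
    · exact Or.inl ⟨hmemT, by rwa [erase_eq_of_notMem haT]⟩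
    · right
      refine ⟨hmemT, ?_⟩
      have h1 := hmem _ hA'
      by_cases ha : a ∈ T
      · rwa [insert_inter_of_mem ha] at h1
      · rw [insert_inter_of_notMem ha] at h1
        exact absurd h1 hmemT

/-- The total size of the members is the measure that makes repeated compression terminate. -/
theorem sum_card_compression_lt {a : α} {F : Finset (Finset α)} {A : Finset α} (hA : A ∈ F)
    (hA' : A.erase a ∉ F) : ∑ S ∈ 𝓓 a F, #S < ∑ S ∈ F, #S := by
  have himg : (F.image fun s => s.erase a).filter (fun s => s ∉ F)
      = (F.filter fun s => s.erase a ∉ F).image fun s => s.erase a := filter_image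
  have hmem : ∀ s ∈ F.filter fun s => s.erase a ∉ F, a ∈ s := by
    intro s hs
    rw [mem_filter] at hs
    by_contra h
    exact hs.2 (by rw [erase_eq_of_notMem h]; exact hs.1)
  rw [Down.compression, sum_disjUnion, himg, sum_image,
    ← sum_filter_add_sum_filter_not F (fun s => s.erase a ∈ F)]
  · refine Nat.add_lt_add_left (sum_lt_sum (fun s _ => card_erase_le) ?_) _
    have hAm : A ∈ F.filter fun s => s.erase a ∉ F := mem_filter.2 ⟨hA, hA'⟩
    exact ⟨A, hAm, card_erase_lt_of_mem (hmem A hAm)⟩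
  · intro s hs t ht h
    rw [← insert_erase (hmem s hs), ← insert_erase (hmem t ht)]
    exact congrArg (insert a) h

theorem isLowerSet_of_erase_mem {F : Finset (Finset α)} (h : ∀ A ∈ F, ∀ a, A.erase a ∈ F) :
    IsLowerSet (F : Set (Finset α)) := by
  intro A B hBA hA
  have key : ∀ S : Finset α, A \ S ∈ F := by
    intro S
    induction S using Finset.induction with
    | empty => simpa using hA
    | insert x S _ ih =>
      rw [sdiff_insert]
      exact h _ ih x
  have := key (A \ B)
  rwa [Finset.sdiff_sdiff_eq_self hBA] at this

/-- Every family can be replaced by a down-set of the same size with no larger traces. -/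
theorem exists_isLowerSet_familyTrace_le (F : Finset (Finset α)) :
    ∃ F' : Finset (Finset α), IsLowerSet (F' : Set (Finset α)) ∧ #F' = #F ∧
      ∀ T, #(familyTrace F' T) ≤ #(familyTrace F T) := by
  induction hN : ∑ S ∈ F, #S using Nat.strong_induction_on generalizing F with
  | _ N ih =>
    subst hN
    by_cases h : ∀ A ∈ F, ∀ a, A.erase a ∈ F
    · exact ⟨F, isLowerSet_of_erase_mem h, rfl, fun _ => le_rfl⟩
    · push Not at h
      obtain ⟨A, hA, a, ha⟩ := h
      obtain ⟨F', h1, h2, h3⟩ := ih _ (sum_card_compression_lt hA ha) (𝓓 a F) rfl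
      refine ⟨F', h1, h2.trans (Down.card_compression a F), fun T => (h3 T).trans ?_⟩
      have := card_le_card (familyTrace_compression_subset a F T)
      rwa [Down.card_compression] at this

end Compression

/-! ### Lower bounds for `maxArrow` -/

/-- A counterexample to arrowing, cut down to exactly `m` members and compressed, is a down-set
whose trace off each `v` includes all members avoiding `v`. Small traces therefore mean degrees
above `s`. -/
theorem le_maxArrow {n s m : ℕ} (hm : m ≤ 2 ^ n)
    (h : ∀ F : Finset (Finset (Fin n)), IsLowerSet (F : Set (Finset (Fin n))) →
      (∀ v, s < #(star F v)) → m < #F) : m ≤ maxArrow n s := by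
  refine (isGreatest_maxArrow n s).2 ⟨hm, fun F hF => ?_⟩
  by_contra! hcon
  obtain ⟨F₀, hF₀, hcard⟩ := exists_subset_card_eq hF
  obtain ⟨F', hlow, hF', htr⟩ := exists_isLowerSet_familyTrace_le F₀
  refine absurd (h F' hlow fun v => ?_) (by omega)
  have h1 := hcon (univ.erase v) (by rw [card_erase_of_mem (mem_univ _)]; simp)
  have h2 : #(familyTrace F₀ (univ.erase v)) ≤ #(familyTrace F (univ.erase v)) :=
    card_le_card (image_subset_image hF₀)
  have h3 : F'.filter (fun A => v ∉ A) ⊆ familyTrace F' (univ.erase v) := by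
    intro A hA
    rw [mem_filter] at hA
    exact mem_image.2 ⟨A, hA.1, by
      rw [inter_erase, inter_univ, erase_eq_of_notMem hA.2]⟩
  have h4 := card_le_card h3
  have h5 := card_filter_mem_add_card_filter_notMem F' v
  have h6 := htr (univ.erase v)
  have h7 : #(star F' v) = #(F'.filter fun A => v ∈ A) := rfl
  omega

/-! ### Upper bounds for `maxArrow` -/

section Pairs

variable {α : Type*} [DecidableEq α]

/-- The sets `A ∌ v` for which both `A` and `insert v A` belong to `F`; their number is the loss in
the trace on the complement of `v`. -/
def pairs (F : Finset (Finset α)) (v : α) : Finset (Finset α) :=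
  F.filter fun A => v ∉ A ∧ insert v A ∈ F

theorem mem_pairs {F : Finset (Finset α)} {v : α} {A : Finset α} :
    A ∈ pairs F v ↔ A ∈ F ∧ v ∉ A ∧ insert v A ∈ F := mem_filter

theorem pairs_subset_pairs {F G : Finset (Finset α)} (h : F ⊆ G) (v : α) :
    pairs F v ⊆ pairs G v := fun A hA => by
  rw [mem_pairs] at hA ⊢
  exact ⟨h hA.1, hA.2.1, h hA.2.2⟩

/-- The upper set of each pair can be discarded without changing the image. -/
theorem card_image_erase_add_card_pairs_le (F : Finset (Finset α)) (v : α) :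
    #(F.image fun A => A.erase v) + #(pairs F v) ≤ #F := by
  set X := (pairs F v).image fun A => insert v A with hX
  have hXF : X ⊆ F := by
    intro S hS
    obtain ⟨A, hA, rfl⟩ := mem_image.1 hS
    exact (mem_pairs.1 hA).2.2
  have hXc : #X = #(pairs F v) := by
    refine card_image_of_injOn fun A hA B hB h => ?_
    rw [mem_coe, mem_pairs] at hA hB
    rw [← erase_insert hA.2.1, ← erase_insert hB.2.1]
    exact congrArg (fun S => S.erase v) h
  have h1 : (F.image fun A => A.erase v) ⊆ (F \ X).image fun A => A.erase v := by
    intro S hS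
    obtain ⟨A, hA, rfl⟩ := mem_image.1 hS
    by_cases hAX : A ∈ X
    · obtain ⟨C, hC, rfl⟩ := mem_image.1 hAX
      rw [mem_pairs] at hC
      refine mem_image.2 ⟨C, mem_sdiff.2 ⟨hC.1, fun h => ?_⟩, ?_⟩
      · obtain ⟨E, -, rfl⟩ := mem_image.1 h
        exact hC.2.1 (mem_insert_self _ _)
      · rw [erase_insert hC.2.1, erase_eq_of_notMem hC.2.1]
    · exact mem_image_of_mem _ (mem_sdiff.2 ⟨hA, hAX⟩)
  have h2 := (card_le_card h1).trans card_image_le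
  have h3 := card_sdiff_add_card_eq_card hXF
  omega

theorem card_pairs_le_card_pairs_map {β : Type*} [DecidableEq β] (f : α ↪ β)
    (F : Finset (Finset α)) (v : α) :
    #(pairs F v) ≤ #(pairs (F.image fun A => A.map f) (f v)) := by
  refine card_le_card_of_injOn (fun A => A.map f) ?_ ((map_injective f).injOn)
  intro A hA
  rw [mem_coe, mem_pairs] at hA ⊢
  refine ⟨mem_image_of_mem _ hA.1, by simpa using hA.2.1, ?_⟩
  rw [← map_insert]
  exact mem_image_of_mem _ hA.2.2

end Pairs

/-- Adding sets only creates pairs, so `F` could be enlarged to exactly `maxArrow n s` members while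
every trace still loses more than `s`. -/
theorem maxArrow_lt_card {n s : ℕ} (hn : 0 < n) {F : Finset (Finset (Fin n))}
    (h : ∀ v, s < #(pairs F v)) : maxArrow n s < #F := by
  by_contra! hle
  obtain ⟨hm, harr⟩ := (isGreatest_maxArrow n s).1
  obtain ⟨F', hFF', -, hF'⟩ := exists_subsuperset_card_eq (subset_univ F) hle
    (by simpa using hm)
  obtain ⟨T, hT, htr⟩ := harr F' hF'.ge
  obtain ⟨v, hv⟩ : ∃ v, v ∉ T := by
    by_contra! hall
    rw [eq_univ_of_forall hall] at hT
    simp at hT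
    omega
  have hTv : T = univ.erase v := by
    refine eq_of_subset_of_card_le (fun x hx => ?_) ?_
    · exact mem_erase.2 ⟨fun h => hv (h ▸ hx), mem_univ _⟩
    · rw [card_erase_of_mem (mem_univ _), hT]; simp
  have htr' : familyTrace F' T = F'.image fun A => A.erase v := by
    refine image_congr fun A _ => ?_
    rw [hTv, inter_erase, inter_univ]
  have h1 := card_image_erase_add_card_pairs_le F' v
  have h2 := card_le_card (pairs_subset_pairs hFF' v)
  have h3 := h v
  rw [htr'] at htr
  omega

/-- Copies of a small family glued along the empty set bound `maxArrow` from above. -/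
theorem maxArrow_le_of_embeddings {W : Type*} [DecidableEq W] {n s K q : ℕ} (hn : 0 < n)
    {𝒢 : Finset (Finset W)} (h0 : ∅ ∈ 𝒢) (hK : #𝒢 ≤ K + 1) (h : ∀ w, s < #(pairs 𝒢 w))
    (e : Fin q → W ↪ Fin n) (he : ∀ v, ∃ j w, e j w = v) : maxArrow n s ≤ q * K := by
  -- The copies may overlap, since extra sets never destroy pairs; counting the empty set once gives
  -- `K` new members per copy.
  set F : Finset (Finset (Fin n)) :=
    insert ∅ (univ.biUnion fun j => (𝒢.erase ∅).image fun A => A.map (e j)) with hF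
  have hsub : ∀ j, (𝒢.image fun A => A.map (e j)) ⊆ F := by
    intro j S hS
    obtain ⟨A, hA, rfl⟩ := mem_image.1 hS
    rw [hF, mem_insert]
    rcases eq_or_ne A ∅ with rfl | hne
    · left; simp
    · right
      exact mem_biUnion.2 ⟨j, mem_univ _, mem_image_of_mem _ (mem_erase.2 ⟨hne, hA⟩)⟩
  have hcard : #F ≤ q * K + 1 := by
    refine (card_insert_le _ _).trans (Nat.add_le_add_right ?_ 1)
    have h1 := card_biUnion_le_card_mul (univ : Finset (Fin q))
      (fun j => (𝒢.erase ∅).image fun A => A.map (e j)) K fun j _ => by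
        refine card_image_le.trans ?_
        rw [card_erase_of_mem h0]; omega
    simpa using h1
  have hlt := maxArrow_lt_card hn (F := F) (s := s) fun v => by
    obtain ⟨j, w, rfl⟩ := he v
    exact ((h w).trans_le (card_pairs_le_card_pairs_map (e j) 𝒢 w)).trans_le
      (card_le_card (pairs_subset_pairs (hsub j) _))
  omega

theorem maxArrow_le_mul {W : Type*} [Fintype W] [DecidableEq W] {n s K q : ℕ}
    {𝒢 : Finset (Finset W)} (h0 : ∅ ∈ 𝒢) (hK : #𝒢 ≤ K + 1) (h : ∀ w, s < #(pairs 𝒢 w))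
    (hW : 0 < Fintype.card W) (hWn : Fintype.card W ≤ n) (hq : n ≤ q * Fintype.card W) :
    maxArrow n s ≤ q * K := by
  set N := Fintype.card W with hN
  have φ : W ≃ Fin N := Fintype.equivFin W
  -- Consecutive intervals of length `N`, pushed back where they would run past `n`; so `n` need not
  -- be a multiple of `N`.
  refine maxArrow_le_of_embeddings (by omega) h0 hK h
    (fun j => φ.toEmbedding.trans
      ⟨fun i => ⟨min (j * N) (n - N) + i, by have := i.2; omega⟩, fun i i' hi => by
        simp only [Fin.mk.injEq] at hi
        exact Fin.ext (by omega)⟩) fun v => ?_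
  have hv := v.2
  have hdiv : (v : ℕ) / N < q := (Nat.div_lt_iff_lt_mul hW).2 (by omega)
  have hmod := Nat.div_add_mod' v N
  have hmodlt := Nat.mod_lt v hW
  refine ⟨⟨v / N, hdiv⟩, φ.symm ⟨v - min (v / N * N) (n - N), by omega⟩, ?_⟩
  apply Fin.ext
  change min ((v : ℕ) / N * N) (n - N) + (φ (φ.symm _) : ℕ) = v
  rw [Equiv.apply_symm_apply]
  change min ((v : ℕ) / N * N) (n - N) + (v - min (v / N * N) (n - N)) = v
  omega

/-! ### Extremal families -/

/-- Each removed set destroys only the pair indexed by its erasure at `w`, and two removed sets with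
the same erasure destroy the same pair. -/
theorem two_pow_le_card_pairs_add {d : ℕ} (R : Finset (Finset (Fin d))) (w : Fin d) :
    2 ^ (d - 1) ≤ #(pairs (univ \ R) w) + #(R.image fun A => A.erase w) := by
  have h1 : #((univ : Finset (Fin d)).erase w).powerset = 2 ^ (d - 1) := by
    rw [card_powerset, card_erase_of_mem (mem_univ _)]; simp
  rw [← h1]
  refine le_trans (card_le_card fun A hA => ?_) (card_union_le _ _)
  have hw : w ∉ A := fun h => notMem_erase w _ (mem_powerset.1 hA h)
  rw [mem_union, mem_pairs]
  simp only [mem_sdiff, mem_univ, true_and]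
  by_cases hAR : A ∈ R
  · exact Or.inr (mem_image.2 ⟨A, hAR, erase_eq_of_notMem hw⟩)
  by_cases hAR' : insert w A ∈ R
  · exact Or.inr (mem_image.2 ⟨_, hAR', erase_insert hw⟩)
  · exact Or.inl ⟨hAR, hw, hAR'⟩

theorem exists_family_fin {d c : ℕ} (hc : 1 ≤ c) (hcd : c ≤ 2 ^ (d - 1)) :
    ∃ 𝒢 : Finset (Finset (Fin d)), ∅ ∈ 𝒢 ∧ #𝒢 ≤ 2 ^ d - c + 1 ∧
      ∀ w, 2 ^ (d - 1) - c < #(pairs 𝒢 w) := by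
  have hpow : 2 ^ (d - 1) ≤ 2 ^ d := Nat.pow_le_pow_right (by norm_num) (by omega)
  obtain ⟨R, hR, hRc⟩ := exists_subset_card_eq
    (s := (univ : Finset (Finset (Fin d))).erase ∅) (n := c - 1) (by
      rw [card_erase_of_mem (mem_univ _)]; simp; omega)
  refine ⟨univ \ R, ?_, ?_, fun w => ?_⟩
  · rw [mem_sdiff]
    exact ⟨mem_univ _, fun h => notMem_erase _ _ (hR h)⟩
  · rw [card_sdiff_of_subset (subset_univ _), hRc]
    simp; omega
  · have h1 := two_pow_le_card_pairs_add R w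
    have h2 : #(R.image fun A => A.erase w) ≤ #R := card_image_le
    omega

/-- The sets removed from each half of the extremal family on `2 * d` vertices. -/
def removedSets {d : ℕ} (x : Fin d) : Finset (Finset (Fin d)) :=
  insert univ ((univ.erase x).image fun y => univ.erase y)

theorem univ_notMem_image_erase {d : ℕ} (x : Fin d) :
    univ ∉ (univ.erase x).image fun y : Fin d => univ.erase y := by
  intro h
  obtain ⟨y, -, hy⟩ := mem_image.1 h
  exact notMem_erase y univ ((Finset.ext_iff.1 hy y).2 (mem_univ y))

theorem card_removedSets {d : ℕ} (x : Fin d) : #(removedSets x) = d := by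
  rw [removedSets, card_insert_of_notMem (univ_notMem_image_erase x), card_image_of_injOn,
    card_erase_of_mem (mem_univ _)]
  · have := x.2
    simp; omega
  · intro y _ z _ h
    by_contra hne
    have h1 : y ∈ univ.erase z := mem_erase.2 ⟨hne, mem_univ _⟩
    rw [← (show univ.erase y = univ.erase z from h)] at h1
    exact notMem_erase y _ h1

theorem notMem_removedSets {d : ℕ} {x : Fin d} {A : Finset (Fin d)} (hA : #A + 1 < d) :
    A ∉ removedSets x := by
  intro h
  rcases mem_insert.1 h with rfl | h
  · simp at hA
  · obtain ⟨y, -, rfl⟩ := mem_image.1 h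
    rw [card_erase_of_mem (mem_univ _)] at hA
    simp at hA
    omega

/-- For `w ≠ x` the removed sets `univ` and `univ.erase w` form one pair, so removing `d` sets
destroys at most `d - 1` pairs. -/
theorem card_image_erase_removedSets_lt {d : ℕ} {x w : Fin d} (hw : w ≠ x) :
    #((removedSets x).image fun A => A.erase w) < d := by
  have h1 : ((removedSets x).image fun A => A.erase w)
      ⊆ ((univ.erase x).image fun y : Fin d => univ.erase y).image fun A => A.erase w := by
    intro S hS
    obtain ⟨A, hA, rfl⟩ := mem_image.1 hS
    rcases mem_insert.1 hA with rfl | hA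
    · exact mem_image.2 ⟨univ.erase w, mem_image.2 ⟨w, mem_erase.2 ⟨hw, mem_univ _⟩, rfl⟩,
        erase_idem⟩
    · exact mem_image_of_mem _ hA
  have h2 := (card_le_card h1).trans card_image_le
  have h3 := card_removedSets x
  rw [removedSets, card_insert_of_notMem (univ_notMem_image_erase x)] at h3
  omega

/-- Only `x` may lose `d` pairs, one too many; the linking edge restores one, namely `{g x}` with
`{f x, g x}`. -/
theorem lt_card_pairs_of_two_blocks {W : Type*} [DecidableEq W] {d : ℕ} (hd : 3 ≤ d)
    (hpow : d ≤ 2 ^ (d - 1)) (x : Fin d) (f g : Fin d ↪ W) (hfg : ∀ i j, f i ≠ g j)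
    {𝒢 : Finset (Finset W)}
    (hf : ((univ \ removedSets x).image fun A => A.map f) ⊆ 𝒢)
    (hg : ((univ \ removedSets x).image fun A => A.map g) ⊆ 𝒢)
    (hx : {f x, g x} ∈ 𝒢) (w : Fin d) : 2 ^ (d - 1) - d < #(pairs 𝒢 (f w)) := by
  have h1 := two_pow_le_card_pairs_add (removedSets x) w
  have h2 := card_pairs_le_card_pairs_map f (univ \ removedSets x) w
  have h3 := card_le_card (pairs_subset_pairs hf (f w))
  rcases eq_or_ne w x with rfl | hne
  · have h4 : #((removedSets w).image fun A => A.erase w) ≤ d :=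
      card_image_le.trans (card_removedSets w).le
    have h5 : {g w} ∉ pairs ((univ \ removedSets w).image fun A => A.map f) (f w) := by
      intro h
      obtain ⟨A, -, hA⟩ := mem_image.1 (mem_pairs.1 h).1
      have h6 : g w ∈ A.map f := hA ▸ mem_singleton_self _
      obtain ⟨i, -, hi⟩ := mem_map.1 h6
      exact hfg _ _ hi
    have h6 : insert {g w} (pairs ((univ \ removedSets w).image fun A => A.map f) (f w))
        ⊆ pairs 𝒢 (f w) := by
      refine insert_subset (mem_pairs.2 ⟨hg ?_, by simpa using hfg w w, hx⟩)
        (pairs_subset_pairs hf _)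
      refine mem_image.2 ⟨{w}, mem_sdiff.2 ⟨mem_univ _, notMem_removedSets (by simp; omega)⟩, ?_⟩
      simp
    have h7 := card_le_card h6
    rw [card_insert_of_notMem h5] at h7
    omega
  · have h4 := card_image_erase_removedSets_lt hne
    omega

theorem exists_family_fin_sum {d : ℕ} (hd : 3 ≤ d) (hpow : d ≤ 2 ^ (d - 1)) :
    ∃ 𝒢 : Finset (Finset (Fin d ⊕ Fin d)), ∅ ∈ 𝒢 ∧ #𝒢 ≤ (2 * 2 ^ d - 2 * d - 1) + 1 ∧
      ∀ w, 2 ^ (d - 1) - d < #(pairs 𝒢 w) := by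
  have hpow' : 2 * 2 ^ (d - 1) = 2 ^ d := by
    rw [← pow_succ', Nat.sub_add_cancel (by omega)]
  set x : Fin d := ⟨0, by omega⟩
  let f : Fin d ↪ Fin d ⊕ Fin d := Function.Embedding.inl
  let g : Fin d ↪ Fin d ⊕ Fin d := Function.Embedding.inr
  set 𝒜 := (univ \ removedSets x).image fun A => A.map f
  set ℬ := (univ \ removedSets x).image fun A => A.map g
  have hempty : ∅ ∈ univ \ removedSets x :=
    mem_sdiff.2 ⟨mem_univ _, notMem_removedSets (by simp; omega)⟩
  have h𝒜 : ∅ ∈ 𝒜 := mem_image.2 ⟨∅, hempty, map_empty _⟩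
  have hℬ : ∅ ∈ ℬ := mem_image.2 ⟨∅, hempty, map_empty _⟩
  have hcard : #(univ \ removedSets x) = 2 ^ d - d := by
    rw [card_sdiff_of_subset (subset_univ _), card_removedSets]; simp
  refine ⟨insert {f x, g x} (𝒜 ∪ ℬ), mem_insert_of_mem (mem_union_left _ h𝒜), ?_, ?_⟩
  · have h1 := card_union_add_card_inter 𝒜 ℬ
    have h2 : 0 < #(𝒜 ∩ ℬ) := card_pos.2 ⟨∅, mem_inter.2 ⟨h𝒜, hℬ⟩⟩
    have h3 : #𝒜 ≤ 2 ^ d - d := hcard ▸ card_image_le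
    have h4 : #ℬ ≤ 2 ^ d - d := hcard ▸ card_image_le
    have h5 := card_insert_le {f x, g x} (𝒜 ∪ ℬ)
    omega
  · have hf : 𝒜 ⊆ insert {f x, g x} (𝒜 ∪ ℬ) := subset_union_left.trans (subset_insert _ _)
    have hg : ℬ ⊆ insert {f x, g x} (𝒜 ∪ ℬ) := subset_union_right.trans (subset_insert _ _)
    rintro (w | w)
    · exact lt_card_pairs_of_two_blocks hd hpow x f g (fun i j => Sum.inl_ne_inr) hf hg
        (mem_insert_self _ _) w
    · exact lt_card_pairs_of_two_blocks hd hpow x g f (fun i j => Sum.inr_ne_inl) hg hf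
        (by rw [pair_comm]; exact mem_insert_self _ _) w

end TraceSets

/-! ### Exact values and limits -/

namespace TraceSets

open Filter Topology

/-- Monotonicity of `2 ^ n / n`, which keeps the lower bound within the range `m ≤ 2 ^ n`. -/
theorem mul_two_pow_le {d n : ℕ} (hd : 1 ≤ d) (hn : d ≤ n) : n * 2 ^ d ≤ d * 2 ^ n := by
  induction n, hn using Nat.le_induction with
  | base => rfl
  | succ n hn ih =>
    have : n + 1 ≤ 2 * n := by omega
    calc (n + 1) * 2 ^ d ≤ 2 * n * 2 ^ d := Nat.mul_le_mul_right _ this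
      _ = 2 * (n * 2 ^ d) := by ring
      _ ≤ 2 * (d * 2 ^ n) := Nat.mul_le_mul_left _ ih
      _ = d * 2 ^ (n + 1) := by ring

theorem le_two_pow_sub_one {d : ℕ} (hd : 50 ≤ d) : d ≤ 2 ^ (d - 1) := by
  have := Nat.lt_two_pow_self (n := d - 1)
  omega

theorem le_maxArrow_of_le_mul {n d c m : ℕ} (hd : 50 ≤ d) (hc : 1 ≤ c) (hcd : c ≤ d) (hn : d ≤ n)
    (hm : (m : ℝ) ≤ n * (((2 : ℝ) ^ d - blockLoss d c) / d)) :
    m ≤ maxArrow n (2 ^ (d - 1) - c) := by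
  have hd' : (50 : ℝ) ≤ d := by exact_mod_cast hd
  have hpow := le_two_pow_sub_one hd
  refine le_maxArrow ?_ fun F hF hdeg => ?_
  · have h1 : (m : ℝ) * d ≤ n * 2 ^ d := by
      rw [← mul_div_assoc, le_div_iff₀ (by linarith)] at hm
      refine hm.trans (mul_le_mul_of_nonneg_left ?_ (by positivity))
      have := le_blockLoss d c
      have : (0 : ℝ) ≤ c := by positivity
      linarith
    have h2 : m * d ≤ n * 2 ^ d := by exact_mod_cast h1
    have h3 := h2.trans (mul_two_pow_le (by omega) hn)
    rw [mul_comm] at h3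
    exact Nat.le_of_mul_le_mul_left h3 (by omega)
  · have hdense : IsDense F d c := ⟨hF, hd, hc, hcd, fun v => by have := hdeg v; omega⟩
    have h := hdense.mul_div_le_card_sub_one (by omega)
    have : (m : ℝ) < F.card := by linarith
    exact_mod_cast this

/-- The value at multiples of the size `N` of an extremal family, and the limit. -/
theorem maxArrow_eq_and_tendsto {W : Type*} [Fintype W] [DecidableEq W] {d c K : ℕ}
    {𝒢 : Finset (Finset W)} (hd : 50 ≤ d) (hc : 1 ≤ c) (hcd : c ≤ d) (h0 : ∅ ∈ 𝒢)
    (hK : 𝒢.card ≤ K + 1) (h : ∀ w, 2 ^ (d - 1) - c < (pairs 𝒢 w).card) (hW : d ≤ Fintype.card W)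
    (hT : (K : ℝ) / Fintype.card W = ((2 : ℝ) ^ d - blockLoss d c) / d) :
    (∀ n : ℕ, 0 < n → Fintype.card W ∣ n →
      (maxArrow n (2 ^ (d - 1) - c) : ℝ) = ((2 : ℝ) ^ d - blockLoss d c) / d * n) ∧
    Tendsto (fun n : ℕ => (maxArrow n (2 ^ (d - 1) - c) : ℝ) / n) atTop
      (𝓝 (((2 : ℝ) ^ d - blockLoss d c) / d)) := by
  have hWpos : 0 < Fintype.card W := by omega
  have hWR : (0 : ℝ) < Fintype.card W := by exact_mod_cast hWpos
  rw [← hT]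
  set N := Fintype.card W with hN
  refine ⟨?_, ?_⟩
  · rintro n hn ⟨q, rfl⟩
    have hq : 0 < q := Nat.pos_of_mul_pos_left hn
    have hNq : N ≤ N * q := Nat.le_mul_of_pos_right N hq
    have hval : (K : ℝ) / N * (N * q : ℕ) = (q * K : ℕ) := by
      push_cast; field_simp
    rw [hval]
    norm_cast
    refine le_antisymm (maxArrow_le_mul h0 hK h hWpos hNq (by rw [mul_comm])) ?_
    refine le_maxArrow_of_le_mul hd hc hcd (hW.trans hNq) ?_
    rw [← hT, mul_comm _ ((K : ℝ) / _), hval]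
  · have hlow : Tendsto (fun n : ℕ => (K : ℝ) / N - 1 / n) atTop (𝓝 ((K : ℝ) / N)) := by
      simpa using tendsto_const_nhds.sub (tendsto_one_div_atTop_nhds_zero_nat (𝕜 := ℝ))
    have hhigh : Tendsto (fun n : ℕ => (K : ℝ) / N + K / n) atTop (𝓝 ((K : ℝ) / N)) := by
      simpa using tendsto_const_nhds.add (tendsto_const_div_atTop_nhds_zero_nat (K : ℝ))
    refine tendsto_of_tendsto_of_tendsto_of_le_of_le' hlow hhigh ?_ ?_
    · filter_upwards [eventually_ge_atTop N] with n hn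
      have hn0 : (0 : ℝ) < n := by exact_mod_cast hWpos.trans_le hn
      have h1 : ⌊(n : ℝ) * (K / N)⌋₊ ≤ maxArrow n (2 ^ (d - 1) - c) := by
        refine le_maxArrow_of_le_mul hd hc hcd (hW.trans hn) ?_
        rw [← hT]
        exact Nat.floor_le (by positivity)
      have h2 : (⌊(n : ℝ) * (K / N)⌋₊ : ℝ) ≤ maxArrow n (2 ^ (d - 1) - c) := by exact_mod_cast h1
      have h3 := Nat.lt_floor_add_one ((n : ℝ) * (K / N))
      rw [le_div_iff₀ hn0, sub_mul, one_div_mul_cancel hn0.ne']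
      linarith
    · filter_upwards [eventually_ge_atTop N] with n hn
      have hn0 : (0 : ℝ) < n := by exact_mod_cast hWpos.trans_le hn
      have h1 := maxArrow_le_mul (q := n / N + 1) h0 hK h hWpos hn
        (Nat.lt_div_mul_add hWpos |>.le.trans (by rw [add_mul, one_mul]))
      have h2 : (maxArrow n (2 ^ (d - 1) - c) : ℝ) ≤ ((n / N : ℕ) + 1) * K := by exact_mod_cast h1
      have h3 : ((n / N : ℕ) : ℝ) ≤ n / N := Nat.cast_div_le
      rw [div_le_iff₀ hn0, add_mul, div_mul_cancel₀ _ hn0.ne']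
      have h4 : ((n / N : ℕ) + 1) * (K : ℝ) ≤ (n / N + 1) * K := by gcongr
      have h5 : ((n : ℝ) / N + 1) * K = K / N * n + K := by ring
      linarith

end TraceSets

theorem theorem1p5 (d : ℕ) (hd : 50 ≤ d) :
    ((∀ n : ℕ, 0 < n → 2 * d ∣ n →
        (maxArrow n (2 ^ (d - 1) - d) : ℝ) = ((2 : ℝ) ^ d - (d : ℝ) - 1 / 2) / (d : ℝ) * (n : ℝ)) ∧
      Filter.Tendsto (fun n : ℕ => (maxArrow n (2 ^ (d - 1) - d) : ℝ) / (n : ℝ)) Filter.atTop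
        (nhds (((2 : ℝ) ^ d - (d : ℝ) - 1 / 2) / (d : ℝ)))) ∧
    (∀ c : ℕ, 1 ≤ c → c ≤ d - 1 →
      (∀ n : ℕ, 0 < n → d ∣ n →
        (maxArrow n (2 ^ (d - 1) - c) : ℝ) = ((2 : ℝ) ^ d - (c : ℝ)) / (d : ℝ) * (n : ℝ)) ∧
      Filter.Tendsto (fun n : ℕ => (maxArrow n (2 ^ (d - 1) - c) : ℝ) / (n : ℝ)) Filter.atTop
        (nhds (((2 : ℝ) ^ d - (c : ℝ)) / (d : ℝ)))) := by
  have hd0 : (d : ℝ) ≠ 0 := by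
    have : d ≠ 0 := by omega
    exact_mod_cast this
  have hpow := TraceSets.le_two_pow_sub_one hd
  have hpow' : 2 * 2 ^ (d - 1) = 2 ^ d := by
    rw [← pow_succ', Nat.sub_add_cancel (by omega)]
  constructor
  · obtain ⟨𝒢, h0, hK, h⟩ := TraceSets.exists_family_fin_sum (d := d) (by omega) hpow
    have hloss : TraceSets.blockLoss d d = (d : ℝ) + 1 / 2 := if_pos rfl
    have hmain := TraceSets.maxArrow_eq_and_tendsto (c := d) hd (by omega) le_rfl h0 hK h
      (by simp) (by
        have h1 : 2 * d + 1 ≤ 2 * 2 ^ d := by omega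
        rw [hloss, Nat.sub_sub, Nat.cast_sub h1, Fintype.card_sum, Fintype.card_fin]
        push_cast
        field_simp
        ring)
    rw [hloss, ← sub_sub, Fintype.card_sum, Fintype.card_fin, ← two_mul] at hmain
    exact hmain
  · intro c hc hcd
    obtain ⟨𝒢, h0, hK, h⟩ := TraceSets.exists_family_fin (d := d) hc (by omega)
    have hloss : TraceSets.blockLoss d c = c := if_neg (by omega)
    have hmain := TraceSets.maxArrow_eq_and_tendsto hd hc (by omega) h0 hK h
      (by simp) (by
        have h1 : c ≤ 2 ^ d := by omega
        rw [hloss, Nat.cast_sub h1, Fintype.card_fin]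
        push_cast
        rfl)
    rw [hloss, Fintype.card_fin] at hmain
    exact hmain
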